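/- **Setting.** Let $\eta\in\{2,3,\dots\}\cup\{\infty\}$, $\kappa\in\{0,1,2,\dots\}$, and put $J_\iota=\{k\in\mathbb N: 1\le k\le\iota\}$. Let $\mathscr T_{\eta,\kappa}$ be the directed tree with vertex set $V=\{-k: k\in J_\kappa\}\sqcup\{0\}\sqcup\{(i,j): i\in J_\eta,\ j\ge 1\}$ and edges $(-k,-k+1)$ for $k\in J_\kappa$, $(0,(i,1))$ for $i\in J_\eta$, and $((i,j),(i,j+1))$ for $i\in J_\eta$, $j\ge1$. Its root is $-\kappa$; let $V^\circ=V\setminus\{-\kappa\}$. For $\lambda=\{\lambda_v\}_{v\in V^\circ}\subseteq\mathbb C$, the weighted shift $S_\lambda$ is the operator in $\ell^2(V)$ given by $(S_\lambda f)(v)=\lambda_v f(\mathrm{par}(v))$ for $v\in V^\circ$, where $\mathrm{par}(v)$ is the parent of $v$, and $(S_\lambda f)(-\kappa)=0$, with domain the set of all $f\in\ell^2(V)$ for which the function so defined is in $\ell^2(V)$. Let $\{e_u\}_{u\in V}$ be the standard orthonormal basis of $\ell^2(V)$ and write $\lambda_{i,j}=\lambda_{(i,j)}$. A real sequence $\{a_n\}_{n\ge0}$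 is completely alternating if $\sum_{j=0}^n(-1)^j\binom nj a_{m+j}\le0$ for all $m\ge0$, $n\ge1$; its representing measure is the unique finite positive Borel measure $\tau$ on $[0,1]$ such that $a_n=a_0+\int_0^1(1+\dots+s^{n-1})\,d\tau(s)$ for all $n\ge1$. A bounded operator $A$ is completely hyperexpansive if $\{\|A^nh\|^2\}_{n\ge0}$ is completely alternating for every vector $h$. For a bounded completely hyperexpansive $S_\lambda$, let $\tau_{i,1}$ be the representing measure of $\{\|S_\lambda^ne_{(i,1)}\|^2\}_{n\ge0}$. If $\kappa\ge1$, a bounded completely hyperexpansive $S_\lambda$ with nonzero weights is extremal if $\|S_\lambda e_{-\kappa}\|=\min\|S_{\tilde\lambda}e_{-\kappa}\|$, the minimum being over all bounded completely hyperexpansive weighted shifts $S_{\tilde\lambda}$ on $\mathscr T_{\eta,\kappa}$ with nonzero weights such that $\tilde\lambda_v=\lambda_v$ for all $v\ne-\kappa+1$. Let $\boldsymbol\tau=\{\tau_i\}_{i\in J_\eta}$ be positive Borel measures on $[0,1]$ with $\sup_{i}\tau_i([0,1])<\infty$. Let $\mathscr U$ be the set of all $t=\{t_i\}_{i\in J_\eta}\subseteq(0,\infty)$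 such that (with $1/0=\infty$) 1. $\sum_i t_i^2<\infty$; 2. $\sum_i t_i^2\ge 1+\sum_i t_i^2\int_0^1\frac1s\,d\tau_i(s)$ if $\kappa=0$, and $\sum_i t_i^2= 1+\sum_i t_i^2\int_0^1\frac1s\,d\tau_i(s)$ if $\kappa\ge1$; 3. $\sum_i t_i^2>\sum_i t_i^2\int_0^1\bigl(\frac1s+\dots+\frac1{s^{\kappa+1}}\bigr)d\tau_i(s)$. Let $\mathscr V$ be the set of all bounded completely hyperexpansive weighted shifts $S_\lambda$ on $\mathscr T_{\eta,\kappa}$ with positive weights such that $\tau_{i,1}=\tau_i$ for all $i\in J_\eta$, and, for $\kappa\ge1$, let $\mathscr W$ be the set of all extremal members of $\mathscr V$. For $t\in\mathscr U$ and $1\le k\le\kappa+1$ put $\zeta_k=\sum_i t_i^2\bigl(1-\int_0^1\sum_{j=1}^k s^{-j}\,d\tau_i(s)\bigr)$. Let $\Phi(t)=S_\lambda$, where $$\lambda_{i,1}=t_i,\qquad \lambda_{i,2}=\sqrt{1+\tau_i([0,1])},\qquad \lambda_{i,j}=\sqrt{\frac{1+\int_0^1(1+\dots+s^{j-2})\,d\tau_i(s)}{1+\int_0^1(1+\dots+s^{j-3})\,d\tau_i(s)}}\quad(j\ge3)$$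 and, if $\kappa\ge1$, $\lambda_0=1/\sqrt{\zeta_2}$ and $\lambda_{-k}=\sqrt{\zeta_{k+1}/\zeta_{k+2}}$ for $k\in J_{\kappa-1}$. **Theorem.** (a) If $\kappa=0$, then $\Phi$ is a bijection from $\mathscr U$ onto $\mathscr V$; moreover, if $S_\lambda\in\mathscr V$ has positive weights $\lambda$, then $t:=\{\lambda_{i,1}\}_i\in\mathscr U$ and $\lambda$ is the system of weights of $\Phi(t)$ given above. (b) If $\kappa\ge1$, then $\Phi$ is a bijection from $\mathscr U$ onto $\mathscr W$. Moreover, if $S_\lambda\in\mathscr V$ has positive weights $\lambda$, then $t:=\{\lambda_{i,1}\}_{i}\in\mathscr U$, $\lambda_{-\kappa+1}\in\bigl[\sqrt{\zeta_\kappa/\zeta_{\kappa+1}},\infty\bigr)$, and $\lambda_v=\tilde\lambda_v$ for all $v\ne-\kappa+1$, where $\tilde\lambda$ is the system of weights of $\Phi(t)$ given above. Conversely, if $t\in\mathscr U$, $\lambda$ is the system of weights of $\Phi(t)$ given above, and $\vartheta\in\bigl[\sqrt{\zeta_\kappa/\zeta_{\kappa+1}},\infty\bigr)$, then the weighted shift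 with weights $\tilde\lambda_v=\lambda_v$ for $v\ne-\kappa+1$ and $\tilde\lambda_{-\kappa+1}=\vartheta$ is a member of $\mathscr V$. -/

import Mathlib

open MeasureTheory
open scoped ENNReal

/-! ### Directed trees -/

/-- A directed tree on the vertex set `V`; `Adj u v` means that `(u, v)` is an edge.
The graph has no loops and no circuits (a closed directed walk contains a loop or a circuit),
it is connected as an undirected graph, and every vertex is the end of at most one edge. -/
structure DirectedTree (V : Type*) where
  Adj : V → V → Prop
  nonempty : Nonempty V
  acyclic : ∀ v, ¬ Relation.TransGen Adj v v
  connected : ∀ u v, Relation.ReflTransGen (fun a b => Adj a b ∨ Adj b a) u v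
  parent_unique : ∀ u u' v, Adj u v → Adj u' v → u = u'

namespace DirectedTree

variable {V : Type*} (T : DirectedTree V)

/-- The set `V°` of all vertices that are not roots. -/
abbrev NonRoot : Type _ := {v : V // ∃ u, T.Adj u v}

/-- The parent of a vertex that is not a root. -/
noncomputable def pa (v : T.NonRoot) : V := v.2.choose

end DirectedTree

/-! ### Weighted shifts on directed trees -/

/-- The Hilbert space `ℓ²(V)` of square summable complex functions on `V`. -/
abbrev Ell2 (V : Type*) : Type _ := lp (fun _ : V => ℂ) 2

open Classical in
/-- The vector `e_u` of the standard orthonormal basis of `ℓ²(V)`. -/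
noncomputable def basisVec {V : Type*} (u : V) : Ell2 V :=
  lp.single (E := fun _ : V => ℂ) 2 u (1 : ℂ)

namespace DirectedTree

variable {V : Type*} (T : DirectedTree V)

open Classical in
/-- The map `Λ_T` on all functions `f : V → ℂ`: `(Λ_T f)(v) = λ_v f(pa v)` if `v` is not a root,
and `(Λ_T f)(v) = 0` if `v` is a root. -/
noncomputable def shiftMap (lam : T.NonRoot → ℂ) : (V → ℂ) →ₗ[ℂ] (V → ℂ) where
  toFun f v := if h : ∃ u, T.Adj u v then lam ⟨v, h⟩ * f (T.pa ⟨v, h⟩) else 0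
  map_add' f g := by
    funext v
    by_cases h : ∃ u, T.Adj u v <;> simp [h, mul_add]
  map_smul' c f := by
    funext v
    by_cases h : ∃ u, T.Adj u v <;> simp [h, mul_left_comm]

/-- The weighted shift `S_λ` as a (possibly unbounded) operator in `ℓ²(V)`, with the domain
`{f ∈ ℓ²(V) : Λ_T f ∈ ℓ²(V)}`. -/
noncomputable def weightedShift (lam : T.NonRoot → ℂ) : Ell2 V →ₗ.[ℂ] Ell2 V where
  domain :=
    { carrier := {f | Memℓp (E := fun _ : V => ℂ) (T.shiftMap lam (fun v => f v)) 2}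
      add_mem' := fun {f g} hf hg => by
        have h := Memℓp.add hf hg
        rw [← map_add] at h
        exact h
      zero_mem' := by
        have h : T.shiftMap lam (fun v => (0 : Ell2 V) v) = 0 := map_zero (T.shiftMap lam)
        change Memℓp (E := fun _ : V => ℂ) (T.shiftMap lam (fun v => (0 : Ell2 V) v)) 2
        rw [h]
        exact zero_memℓp
      smul_mem' := fun c f hf => by
        have h := Memℓp.const_smul hf c
        rw [← map_smul] at h
        exact h }
  toFun :=
    { toFun := fun f => ⟨T.shiftMap lam (fun v => f.1 v), f.2⟩
      map_add' := fun f g => Subtype.ext (map_add (T.shiftMap lam) (fun v => f.1 v) fun v => g.1 v)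
      map_smul' := fun c f => Subtype.ext (map_smul (T.shiftMap lam) c fun v => f.1 v) }

/-- `S_λ` is everywhere defined and bounded, and it is the operator `A ∈ B(ℓ²(V))`. -/
def IsShift (lam : T.NonRoot → ℂ) (A : Ell2 V →L[ℂ] Ell2 V) : Prop :=
  T.weightedShift lam = (A : Ell2 V →ₗ[ℂ] Ell2 V).toPMap ⊤

end DirectedTree

/-! ### Completely alternating sequences and completely hyperexpansive operators -/

def CompletelyAlternating (a : ℕ → ℝ) : Prop :=
  ∀ m n : ℕ, 1 ≤ n → ∑ j ∈ Finset.range (n + 1), (-1 : ℝ) ^ j * (n.choose j : ℝ) * a (m + j) ≤ 0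

/-- `∫₀¹ (1 + s + ⋯ + s^(n-1)) dτ(s)`. -/
noncomputable def geomIntegral (τ : Measure unitInterval) (n : ℕ) : ℝ :=
  ∫ s, ∑ l ∈ Finset.range n, (s : ℝ) ^ l ∂τ

/-- `τ` is the representing measure of the completely alternating sequence `a`. -/
def IsRepresentingMeasure (τ : Measure unitInterval) (a : ℕ → ℝ) : Prop :=
  IsFiniteMeasure τ ∧ ∀ n : ℕ, 1 ≤ n → a n = a 0 + geomIntegral τ n

def CompletelyHyperexpansive {H : Type*} [NormedAddCommGroup H] [InnerProductSpace ℂ H]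
    (A : H →L[ℂ] H) : Prop :=
  ∀ h : H, CompletelyAlternating fun n => ‖(A ^ n) h‖ ^ 2

/-! ### The directed trees `T_{η,κ}` with one branching vertex -/

/-- `J_η = {i ∈ ℕ : 1 ≤ i ≤ η}`. -/
abbrev JSet (η : ℕ∞) : Type := {i : ℕ // 1 ≤ i ∧ (i : ℕ∞) ≤ η}

/-- The vertices of `T_{η,κ}`: `trunk k` is the vertex `-k` for `0 ≤ k ≤ κ`, and `ray i j` is the
vertex `(i, j + 1)` for `i ∈ J_η` and `j = 0, 1, 2, …`. -/
inductive Vertex (η : ℕ∞) (κ : ℕ) : Type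
  | trunk (k : ℕ) (hk : k ≤ κ) : Vertex η κ
  | ray (i : JSet η) (j : ℕ) : Vertex η κ

/-- The edges of `T_{η,κ}`: `(-(k+1), -k)` for `0 ≤ k < κ`, `(0, (i, 1))`, and
`((i, j), (i, j + 1))`. -/
inductive Edge (η : ℕ∞) (κ : ℕ) : Vertex η κ → Vertex η κ → Prop
  | trunk (k : ℕ) (hk : k < κ) : Edge η κ (.trunk (k + 1) hk) (.trunk k hk.le)
  | branch (i : JSet η) : Edge η κ (.trunk 0 κ.zero_le) (.ray i 0)
  | ray (i : JSet η) (j : ℕ) : Edge η κ (.ray i j) (.ray i (j + 1))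

/-- The level of a vertex, with the branching vertex on level zero. -/
def Vertex.level {η : ℕ∞} {κ : ℕ} : Vertex η κ → ℤ
  | .trunk k _ => -(k : ℤ)
  | .ray _ j => (j : ℤ) + 1

theorem Edge.level_lt {η : ℕ∞} {κ : ℕ} {u v : Vertex η κ} (h : Edge η κ u v) :
    u.level < v.level := by
  cases h <;> simp [Vertex.level]

theorem Edge.transGen_level_lt {η : ℕ∞} {κ : ℕ} {u v : Vertex η κ}
    (h : Relation.TransGen (Edge η κ) u v) : u.level < v.level := by
  induction h with
  | single h => exact h.level_lt
  | tail _ h ih => exact ih.trans h.level_lt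

theorem Vertex.reach_zero {η : ℕ∞} {κ : ℕ} (v : Vertex η κ) :
    Relation.ReflTransGen (fun a b => Edge η κ a b ∨ Edge η κ b a) (.trunk 0 κ.zero_le) v := by
  cases v with
  | trunk k hk =>
    induction k with
    | zero => exact .refl
    | succ k ih => exact (ih (Nat.le_of_succ_le hk)).tail (.inr (.trunk k hk))
  | ray i j =>
    induction j with
    | zero => exact .single (.inl (.branch i))
    | succ j ih => exact ih.tail (.inl (.ray i j))

/-- The directed tree `T_{η,κ}`. -/
def tree (η : ℕ∞) (κ : ℕ) : DirectedTree (Vertex η κ) where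
  Adj := Edge η κ
  nonempty := ⟨.trunk 0 κ.zero_le⟩
  acyclic v h := lt_irrefl _ (Edge.transGen_level_lt h)
  connected u v := by
    have : Std.Symm (fun a b => Edge η κ a b ∨ Edge η κ b a) := ⟨fun a b h => h.symm⟩
    exact (Relation.ReflTransGen.stdSymm.symm _ _ u.reach_zero).trans v.reach_zero
  parent_unique u u' v h h' := by
    cases h <;> cases h' <;> rfl

/-- The root `-κ` of `T_{η,κ}`. -/
def rootVertex (η : ℕ∞) (κ : ℕ) : Vertex η κ := .trunk κ le_rfl

/-- The child `(i, 1)` of the branching vertex `0`. -/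
def branchChild {η : ℕ∞} {κ : ℕ} (i : JSet η) : (tree η κ).NonRoot :=
  ⟨.ray i 0, _, .branch i⟩

/-- The only child `-κ + 1` of the root `-κ`, for `κ ≥ 1`. -/
def rootChild (η : ℕ∞) {κ : ℕ} (hκ : 1 ≤ κ) : (tree η κ).NonRoot :=
  ⟨.trunk (κ - 1) (Nat.sub_le κ 1), _, .trunk (κ - 1) (Nat.sub_one_lt_of_le hκ le_rfl)⟩

/-- The weighted shift on `T_{η,κ}` with real weights. -/
noncomputable def realShift {η : ℕ∞} {κ : ℕ} (lam : (tree η κ).NonRoot → ℝ) :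
    Ell2 (Vertex η κ) →ₗ.[ℂ] Ell2 (Vertex η κ) :=
  (tree η κ).weightedShift fun v => (lam v : ℂ)

/-- For `κ ≥ 1`: `S` is an extremal completely hyperexpansive weighted shift on `T_{η,κ}`, that is,
a bounded completely hyperexpansive weighted shift `S_λ` with nonzero weights for which
`‖S_λ e_root‖` is the least among all bounded completely hyperexpansive weighted shifts with nonzero
weights that agree with `λ` at all vertices other than `-κ + 1`. -/
def IsExtremal {η : ℕ∞} {κ : ℕ} (hκ : 1 ≤ κ)
    (S : Ell2 (Vertex η κ) →ₗ.[ℂ] Ell2 (Vertex η κ)) : Prop :=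
  ∃ (lam : (tree η κ).NonRoot → ℂ) (A : Ell2 (Vertex η κ) →L[ℂ] Ell2 (Vertex η κ)),
    S = (tree η κ).weightedShift lam ∧
    (∀ v, lam v ≠ 0) ∧ (tree η κ).IsShift lam A ∧ CompletelyHyperexpansive A ∧
    IsLeast {r : ℝ | ∃ (lam' : (tree η κ).NonRoot → ℂ)
        (B : Ell2 (Vertex η κ) →L[ℂ] Ell2 (Vertex η κ)),
        (∀ v, lam' v ≠ 0) ∧ (tree η κ).IsShift lam' B ∧ CompletelyHyperexpansive B ∧
        (∀ v, v ≠ rootChild η hκ → lam v = lam' v) ∧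
        r = ‖B (basisVec (rootVertex η κ))‖}
      ‖A (basisVec (rootVertex η κ))‖

/-! ### The parametrization -/

/-- `∫₀¹ (1/s + ⋯ + 1/s^k) dτ(s) ∈ [0,∞]`, with `1/0 = ∞`. -/
noncomputable def invMoment (τ : Measure unitInterval) (k : ℕ) : ℝ≥0∞ :=
  ∫⁻ s, ∑ j ∈ Finset.Icc 1 k, 1 / (ENNReal.ofReal (s : ℝ)) ^ j ∂τ

/-- The set `U_{η,κ}^τ` of parameters `t`; the sums are taken in `[0,∞]`. -/
def paramSet (η : ℕ∞) (κ : ℕ) (τ : JSet η → Measure unitInterval) : Set (JSet η → ℝ) :=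
  {t | (∀ i, 0 < t i) ∧
    ∑' i, ENNReal.ofReal (t i ^ 2) < ⊤ ∧
    (κ = 0 → 1 + ∑' i, ENNReal.ofReal (t i ^ 2) * invMoment (τ i) 1 ≤
      ∑' i, ENNReal.ofReal (t i ^ 2)) ∧
    (0 < κ → ∑' i, ENNReal.ofReal (t i ^ 2) =
      1 + ∑' i, ENNReal.ofReal (t i ^ 2) * invMoment (τ i) 1) ∧
    ∑' i, ENNReal.ofReal (t i ^ 2) * invMoment (τ i) (κ + 1) <
      ∑' i, ENNReal.ofReal (t i ^ 2)}

/-- The set `V_{η,κ}^τ` of all bounded completely hyperexpansive weighted shifts on `T_{η,κ}` with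
positive weights such that `τ_{i,1} = τ_i` for all `i`. -/
def shiftSet (η : ℕ∞) (κ : ℕ) (τ : JSet η → Measure unitInterval) :
    Set (Ell2 (Vertex η κ) →ₗ.[ℂ] Ell2 (Vertex η κ)) :=
  {S | ∃ (lam : (tree η κ).NonRoot → ℝ) (A : Ell2 (Vertex η κ) →L[ℂ] Ell2 (Vertex η κ)),
    S = realShift lam ∧ (∀ v, 0 < lam v) ∧ (tree η κ).IsShift (fun v => (lam v : ℂ)) A ∧
    CompletelyHyperexpansive A ∧
    ∀ i, IsRepresentingMeasure (τ i) fun n => ‖(A ^ n) (basisVec (.ray i 0))‖ ^ 2}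

/-- The set `W_{η,κ}^τ` of all extremal members of `V_{η,κ}^τ`, for `κ ≥ 1`. -/
def extremalSet (η : ℕ∞) {κ : ℕ} (hκ : 1 ≤ κ) (τ : JSet η → Measure unitInterval) :
    Set (Ell2 (Vertex η κ) →ₗ.[ℂ] Ell2 (Vertex η κ)) :=
  {S | S ∈ shiftSet η κ τ ∧ IsExtremal hκ S}

/-- `ζ_k = ∑ᵢ tᵢ² (1 - ∫₀¹ (1/s + ⋯ + 1/s^k) dτᵢ(s))`; it is used only for `k ≤ κ + 1` and for
`t` in `paramSet η κ τ`, where all integrals are finite and the series converges absolutely. -/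
noncomputable def zeta {η : ℕ∞} (τ : JSet η → Measure unitInterval) (t : JSet η → ℝ) (k : ℕ) : ℝ :=
  ∑' i, t i ^ 2 * (1 - (invMoment (τ i) k).toReal)

/-- The explicit weights given by `t`. Recall that `ray i j` is `(i, j + 1)`: the first three cases
are `λ_{i,1}`, `λ_{i,2}` and `λ_{i,j}` with `j ≥ 3`, the last one is `λ_{-k}`. -/
noncomputable def modelWeight {η : ℕ∞} {κ : ℕ} (τ : JSet η → Measure unitInterval)
    (t : JSet η → ℝ) : Vertex η κ → ℝ
  | .ray i 0 => t i
  | .ray i 1 => Real.sqrt (1 + (τ i).real Set.univ)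
  | .ray i (j + 2) =>
      Real.sqrt ((1 + geomIntegral (τ i) (j + 2)) / (1 + geomIntegral (τ i) (j + 1)))
  | .trunk k _ =>
      if k = 0 then 1 / Real.sqrt (zeta τ t 2)
      else Real.sqrt (zeta τ t (k + 1) / zeta τ t (k + 2))

/-- The map `Φ_{η,κ}`. -/
noncomputable def modelMap (η : ℕ∞) (κ : ℕ) (τ : JSet η → Measure unitInterval)
    (t : JSet η → ℝ) : Ell2 (Vertex η κ) →ₗ.[ℂ] Ell2 (Vertex η κ) :=
  realShift fun v : (tree η κ).NonRoot => modelWeight τ t v.1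

/-! ### Completely alternating sequences -/

/-! The images `(A ^ n) e_u` for different `u` have disjoint supports, so `‖(A ^ n) f‖²` is the sum
of `|f u|² ‖(A ^ n) e_u‖²`. Complete hyperexpansivity therefore only has to be tested on basis
vectors (`IsShift.completelyHyperexpansive_iff`). On a ray it follows from the prescribed measure `τ
i`, since every orbit there is a rescaled tail of the orbit of `(i, 1)`. The trunk vertices `-k`
carry the real content.

At the branching vertex the increments of `‖(A ^ n) e_0‖²` are, from the second one on, the moments
of `ρ = ∑ tᵢ² τᵢ`. Each step down the trunk prepends one term to the sequence and rescales the rest.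
If the later increments are the moments of `σ`, the longer sequence `a` is completely alternating
exactly when `∫ s⁻¹ dσ ≤ a 1 - a 0`. In that case its increments are the moments of `s⁻¹ dσ` plus
the slack as an atom at `0` (`CompletelyAlternating.negMoment_le`, `exists_incrementsAreMoments`).
An atom at `0` makes the next inverse moment infinite, so the inequality must be an equality at
every vertex except the root.

With `w_k` the product of the first `k` squared trunk weights, these conditions telescope to `w_k
ζ_{k+1} = 1` for `k < κ` and `w_κ ζ_{κ+1} ≥ 1` (`BackwardChain.completelyAlternating_iff_zeta`).
Solving them yields the parameter set, fixes all trunk weights but the last, and leaves a sharp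
lower bound for that one (`completelyHyperexpansive_iff_weights`). Extremality means that this bound
is attained. Injectivity is clear, because `t` is part of the weights and the operator determines
its weights. -/

/-- Pascal's rule: an alternating sum of order `n + 1` is minus one of order `n` of the first
differences. -/
theorem sum_alternating_succ (a : ℕ → ℝ) (m n : ℕ) :
    ∑ j ∈ Finset.range (n + 2), (-1 : ℝ) ^ j * ((n + 1).choose j : ℝ) * a (m + j) =
      -∑ j ∈ Finset.range (n + 1),
        (-1 : ℝ) ^ j * (n.choose j : ℝ) * (a (m + j + 1) - a (m + j)) := by
  have h1 : ∑ j ∈ Finset.range (n + 1), (-1 : ℝ) ^ j * (n.choose j : ℝ) * a (m + j) =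
      ∑ j ∈ Finset.range (n + 1), (-1 : ℝ) ^ (j + 1) * (n.choose (j + 1) : ℝ) * a (m + (j + 1))
        + a m := by
    have h2 : ∑ j ∈ Finset.range (n + 2), (-1 : ℝ) ^ j * (n.choose j : ℝ) * a (m + j) =
        ∑ j ∈ Finset.range (n + 1), (-1 : ℝ) ^ j * (n.choose j : ℝ) * a (m + j) := by
      rw [Finset.sum_range_succ _ (n + 1)]
      simp
    rw [← h2, Finset.sum_range_succ']
    simp
  simp only [mul_sub, Finset.sum_sub_distrib]
  rw [h1, Finset.sum_range_succ', neg_sub, sub_eq_add_neg, ← Finset.sum_neg_distrib,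
    add_right_comm, ← Finset.sum_add_distrib]
  simp only [Nat.choose_zero_right, pow_zero, Nat.cast_one, one_mul, add_zero]
  congr 1
  refine Finset.sum_congr rfl fun j _ => ?_
  rw [Nat.choose_succ_succ, ← add_assoc]
  push_cast
  ring

/-- Complete alternation is complete monotonicity of the increments, the form in which Hausdorff
moments enter. -/
theorem completelyAlternating_iff (a : ℕ → ℝ) :
    CompletelyAlternating a ↔ ∀ m n : ℕ, 0 ≤ ∑ j ∈ Finset.range (n + 1),
      (-1 : ℝ) ^ j * (n.choose j : ℝ) * (a (m + j + 1) - a (m + j)) := by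
  constructor
  · intro h m n
    have := h m (n + 1) (by omega)
    rw [sum_alternating_succ] at this
    linarith
  · intro h m n hn
    obtain ⟨n, rfl⟩ : ∃ k, n = k + 1 := ⟨n - 1, by omega⟩
    rw [sum_alternating_succ]
    linarith [h m n]

theorem CompletelyAlternating.const_mul_shift {a : ℕ → ℝ} (ha : CompletelyAlternating a) {c : ℝ}
    (hc : 0 ≤ c) (l : ℕ) : CompletelyAlternating fun n => c * a (l + n) := by
  intro m n hn
  have := mul_nonpos_of_nonneg_of_nonpos hc (ha (l + m) n hn)
  rw [Finset.mul_sum] at this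
  refine le_of_eq_of_le (Finset.sum_congr rfl fun j _ => ?_) this
  simp only [add_assoc]
  ring

/-! ### Moments of measures on the unit interval -/

theorem integrable_of_continuous_unitInterval (μ : Measure unitInterval) [IsFiniteMeasure μ]
    {f : unitInterval → ℝ} (hf : Continuous f) : Integrable f μ := by
  have := hf.continuousOn.integrableOn_compact (μ := μ) (isCompact_univ (X := unitInterval))
  rwa [integrableOn_univ] at this

/-- The moment `∫ s ^ n dμ(s)`. -/
noncomputable def powMoment (μ : Measure unitInterval) (n : ℕ) : ℝ := ∫ s, (s : ℝ) ^ n ∂μ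

/-- The moment `∫ s ^ (-n) dμ(s) ∈ [0, ∞]`. -/
noncomputable def negMoment (μ : Measure unitInterval) (n : ℕ) : ℝ≥0∞ :=
  ∫⁻ s, (ENNReal.ofReal (s : ℝ))⁻¹ ^ n ∂μ

theorem measurable_invPow (n : ℕ) :
    Measurable fun s : unitInterval => (ENNReal.ofReal (s : ℝ))⁻¹ ^ n := by fun_prop

theorem invMoment_eq_sum (μ : Measure unitInterval) (k : ℕ) :
    invMoment μ k = ∑ j ∈ Finset.Icc 1 k, negMoment μ j := by
  unfold invMoment negMoment
  rw [← lintegral_finsetSum _ fun j _ => measurable_invPow j]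
  simp only [one_div, ENNReal.inv_pow]

theorem powMoment_eq_lintegral (μ : Measure unitInterval) (n : ℕ) :
    powMoment μ n = (∫⁻ s, ENNReal.ofReal (s : ℝ) ^ n ∂μ).toReal := by
  unfold powMoment
  rw [integral_eq_lintegral_of_nonneg_ae]
  · congr 1
    exact lintegral_congr fun s => ENNReal.ofReal_pow s.2.1 n
  · exact .of_forall fun s => pow_nonneg s.2.1 n
  · exact (by fun_prop : Continuous fun s : unitInterval => (s : ℝ) ^ n).aestronglyMeasurable

theorem sum_alternating_powMoment (μ : Measure unitInterval) [IsFiniteMeasure μ] (m n : ℕ) :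
    ∑ j ∈ Finset.range (n + 1), (-1 : ℝ) ^ j * (n.choose j : ℝ) * powMoment μ (m + j) =
      ∫ s, (s : ℝ) ^ m * (1 - (s : ℝ)) ^ n ∂μ := by
  simp only [powMoment, ← integral_const_mul]
  rw [← integral_finsetSum _ fun j _ =>
    integrable_of_continuous_unitInterval μ (by fun_prop)]
  congr 1
  funext s
  rw [show (1 - (s : ℝ)) = -(s : ℝ) + 1 by ring, add_pow, Finset.mul_sum]
  refine Finset.sum_congr rfl fun j _ => ?_
  rw [neg_pow, pow_add]
  ring

/-- The increments of `a` are the moments of the finite measure `μ`. -/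
def IncrementsAreMoments (a : ℕ → ℝ) (μ : Measure unitInterval) : Prop :=
  IsFiniteMeasure μ ∧ ∀ n, a (n + 1) - a n = powMoment μ n

/-- The binomial sums of the increments are the integrals of `s ^ m (1 - s) ^ n`, which is
nonnegative on `[0, 1]`. -/
theorem IncrementsAreMoments.completelyAlternating {a : ℕ → ℝ} {μ : Measure unitInterval}
    (h : IncrementsAreMoments a μ) : CompletelyAlternating a := by
  have := h.1
  rw [completelyAlternating_iff]
  intro m n
  simp only [h.2]
  rw [sum_alternating_powMoment]
  exact integral_nonneg fun s => mul_nonneg (pow_nonneg s.2.1 _)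
    (pow_nonneg (sub_nonneg.2 s.2.2) _)

theorem geomIntegral_succ (μ : Measure unitInterval) [IsFiniteMeasure μ] (n : ℕ) :
    geomIntegral μ (n + 1) = geomIntegral μ n + powMoment μ n := by
  unfold geomIntegral powMoment
  rw [← integral_add (integrable_of_continuous_unitInterval μ (by fun_prop))
    (integrable_of_continuous_unitInterval μ (by fun_prop))]
  simp only [Finset.sum_range_succ]

theorem geomIntegral_zero (μ : Measure unitInterval) : geomIntegral μ 0 = 0 := by
  simp [geomIntegral]

theorem powMoment_nonneg (μ : Measure unitInterval) (n : ℕ) : 0 ≤ powMoment μ n :=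
  integral_nonneg fun s => pow_nonneg s.2.1 n

theorem powMoment_le (μ : Measure unitInterval) [IsFiniteMeasure μ] (n : ℕ) :
    powMoment μ n ≤ μ.real Set.univ := by
  unfold powMoment
  calc ∫ s, (s : ℝ) ^ n ∂μ ≤ ∫ _, (1 : ℝ) ∂μ :=
        integral_mono (integrable_of_continuous_unitInterval μ (by fun_prop))
          (integrable_const _) fun s => pow_le_one₀ s.2.1 s.2.2
    _ = _ := by simp

theorem powMoment_zero (μ : Measure unitInterval) : powMoment μ 0 = μ.real Set.univ := by
  simp [powMoment]

theorem geomIntegral_nonneg (μ : Measure unitInterval) (n : ℕ) : 0 ≤ geomIntegral μ n :=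
  integral_nonneg fun s => Finset.sum_nonneg fun l _ => pow_nonneg s.2.1 l

theorem isRepresentingMeasure_iff (μ : Measure unitInterval) (a : ℕ → ℝ) :
    IsRepresentingMeasure μ a ↔ IncrementsAreMoments a μ := by
  unfold IsRepresentingMeasure IncrementsAreMoments
  refine and_congr_right fun hμ => ⟨fun h n => ?_, fun h n _ => ?_⟩
  · rw [h (n + 1) (by omega), geomIntegral_succ]
    rcases n with _ | n
    · simp [geomIntegral_zero]
    · rw [h (n + 1) (by omega)]
      ring
  · induction n with
    | zero => simp [geomIntegral_zero]
    | succ n ih =>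
      have := h n
      rw [geomIntegral_succ]
      rcases n with _ | n
      · simp only [geomIntegral_zero]
        linarith
      · linarith [ih (by omega)]

/-! ### Backward extensions -/

/-- The alternating sums starting at index `0` are `a 1 - a 0` minus the partial sums of `∑ ∫ (1 -
s) ^ l dρ`, and the geometric series adds up to `1 / s`. Since the tail already has a measure,
Hausdorff's theorem is not needed. -/
theorem CompletelyAlternating.negMoment_le {a : ℕ → ℝ} (ha : CompletelyAlternating a)
    {ρ : Measure unitInterval} [IsFiniteMeasure ρ]
    (h : ∀ n, a (n + 2) - a (n + 1) = powMoment ρ n) :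
    0 ≤ a 1 - a 0 ∧ negMoment ρ 1 ≤ ENNReal.ofReal (a 1 - a 0) := by
  rw [completelyAlternating_iff] at ha
  have key : ∀ n, ∑ j ∈ Finset.range (n + 1),
      (-1 : ℝ) ^ j * (n.choose j : ℝ) * (a (0 + j + 1) - a (0 + j)) =
      (a 1 - a 0) - ∑ l ∈ Finset.range n, ∫ s : unitInterval, (1 - (s : ℝ)) ^ l ∂ρ := by
    intro n
    induction n with
    | zero => simp
    | succ n ih =>
      have h1 := sum_alternating_succ (fun j => a (j + 1) - a j) 0 n
      rw [h1, Finset.sum_range_succ (fun l => ∫ s : unitInterval, (1 - (s : ℝ)) ^ l ∂ρ) n, ← sub_sub, ← ih]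
      have h2 := sum_alternating_powMoment ρ 0 n
      simp only [pow_zero, one_mul] at h2
      rw [← h2, ← Finset.sum_sub_distrib, ← Finset.sum_neg_distrib]
      refine Finset.sum_congr rfl fun j _ => ?_
      rw [← h (0 + j)]
      ring
  have h0 : 0 ≤ a 1 - a 0 := by simpa using ha 0 0
  refine ⟨h0, ?_⟩
  -- In `[0, ∞]` this also holds at `s = 0`, where both sides are infinite; no condition on `ρ {0}`
  -- is needed.
  have hgeom : ∀ s : unitInterval, (ENNReal.ofReal (s : ℝ))⁻¹ ^ 1 =
      ∑' l : ℕ, ENNReal.ofReal ((1 - (s : ℝ)) ^ l) := by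
    intro s
    have h1 : (0 : ℝ) ≤ 1 - s := sub_nonneg.2 s.2.2
    simp only [ENNReal.ofReal_pow h1]
    rw [ENNReal.tsum_geometric, ENNReal.ofReal_sub _ s.2.1, ENNReal.ofReal_one, pow_one,
      ENNReal.sub_sub_cancel ENNReal.one_ne_top (ENNReal.ofReal_le_one.2 s.2.2)]
  unfold negMoment
  simp only [hgeom]
  rw [lintegral_tsum fun l => by fun_prop]
  refine ENNReal.tsum_le_of_sum_range_le fun n => ?_
  have h2 : ∀ l, ∫⁻ s : unitInterval, ENNReal.ofReal ((1 - (s : ℝ)) ^ l) ∂ρ =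
      ENNReal.ofReal (∫ s : unitInterval, (1 - (s : ℝ)) ^ l ∂ρ) := fun l =>
    (ofReal_integral_eq_lintegral_ofReal
      (integrable_of_continuous_unitInterval ρ (by fun_prop))
      (.of_forall fun s => pow_nonneg (sub_nonneg.2 s.2.2) _)).symm
  simp only [h2]
  rw [← ENNReal.ofReal_sum_of_nonneg fun l _ =>
    integral_nonneg fun s => pow_nonneg (sub_nonneg.2 s.2.2) _]
  have h3 := ha 0 n
  rw [key] at h3
  exact ENNReal.ofReal_le_ofReal (by linarith)

/-- The measure `s⁻¹ dρ(s)`. -/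
noncomputable def divMeasure (ρ : Measure unitInterval) : Measure unitInterval :=
  ρ.withDensity fun s => (ENNReal.ofReal (s : ℝ))⁻¹

theorem negMoment_divMeasure (ρ : Measure unitInterval) (j : ℕ) :
    negMoment (divMeasure ρ) j = negMoment ρ (j + 1) := by
  unfold negMoment divMeasure
  rw [lintegral_withDensity_eq_lintegral_mul _ (by fun_prop) (by fun_prop)]
  simp only [Pi.mul_apply, pow_succ']

theorem negMoment_smul (c : ℝ≥0∞) (ρ : Measure unitInterval) (j : ℕ) :
    negMoment (c • ρ) j = c * negMoment ρ j := by
  simp [negMoment, lintegral_smul_measure]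

theorem negMoment_zero (ρ : Measure unitInterval) : negMoment ρ 0 = ρ Set.univ := by
  simp [negMoment]

/-- Finiteness of the inverse moment excludes an atom at `0`, so `s · s⁻¹ = 1` holds almost
everywhere. -/
theorem lintegral_pow_divMeasure {ρ : Measure unitInterval} (h : negMoment ρ 1 < ⊤) (n : ℕ) :
    ∫⁻ s, ENNReal.ofReal (s : ℝ) ^ (n + 1) ∂divMeasure ρ =
      ∫⁻ s, ENNReal.ofReal (s : ℝ) ^ n ∂ρ := by
  unfold divMeasure
  rw [lintegral_withDensity_eq_lintegral_mul _ (by fun_prop) (by fun_prop)]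
  refine lintegral_congr_ae ?_
  filter_upwards [ae_lt_top (measurable_invPow 1) h.ne] with s hs
  have h0 : ENNReal.ofReal (s : ℝ) ≠ 0 := by
    intro h0
    simp [h0] at hs
  rw [Pi.mul_apply, pow_succ', ← mul_assoc, ENNReal.inv_mul_cancel h0 ENNReal.ofReal_ne_top,
    one_mul]

/-- Dividing by `s` shifts the moments by one. The total mass is then corrected by an atom at `0`,
which affects no moment but the zeroth. -/
theorem exists_incrementsAreMoments {a : ℕ → ℝ} {ρ : Measure unitInterval}
    (h : ∀ n, a (n + 2) - a (n + 1) = powMoment ρ n) (h0 : 0 ≤ a 1 - a 0)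
    (hq : negMoment ρ 1 ≤ ENNReal.ofReal (a 1 - a 0)) :
    IncrementsAreMoments a (divMeasure ρ +
      (ENNReal.ofReal (a 1 - a 0) - negMoment ρ 1) • Measure.dirac (0 : unitInterval)) := by
  have hq' : negMoment ρ 1 < ⊤ := hq.trans_lt ENNReal.ofReal_lt_top
  set c := ENNReal.ofReal (a 1 - a 0) - negMoment ρ 1 with hc
  have huniv : (divMeasure ρ + c • Measure.dirac (0 : unitInterval)) Set.univ =
      ENNReal.ofReal (a 1 - a 0) := by
    rw [Measure.add_apply, ← negMoment_zero, negMoment_divMeasure, zero_add]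
    simp only [Measure.smul_apply, measure_univ, smul_eq_mul, mul_one]
    rw [hc, add_tsub_cancel_of_le hq]
  refine ⟨⟨by rw [huniv]; exact ENNReal.ofReal_lt_top⟩, fun n => ?_⟩
  rcases n with _ | n
  · rw [powMoment_zero, Measure.real, huniv, ENNReal.toReal_ofReal h0]
  · rw [h, powMoment_eq_lintegral, powMoment_eq_lintegral, lintegral_add_measure,
      lintegral_pow_divMeasure hq', lintegral_smul_measure, lintegral_dirac]
    simp

theorem negMoment_add_dirac_lt_top {μ : Measure unitInterval} {c : ℝ≥0∞}
    (h : negMoment (μ + c • Measure.dirac (0 : unitInterval)) 1 < ⊤) : c = 0 := by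
  by_contra hc
  unfold negMoment at h
  rw [lintegral_add_measure, lintegral_smul_measure, lintegral_dirac] at h
  simp [ENNReal.mul_top hc] at h

theorem powMoment_ofReal_smul {x : ℝ} (hx : 0 ≤ x) (μ : Measure unitInterval) (n : ℕ) :
    powMoment (ENNReal.ofReal x • μ) n = x * powMoment μ n := by
  unfold powMoment
  rw [integral_smul_measure, ENNReal.toReal_ofReal hx, smul_eq_mul]

/-! ### Iterated backward extensions -/

section Chain

variable {a : ℕ → ℕ → ℝ} {x : ℕ → ℝ} {ρ : Measure unitInterval} {κ : ℕ}

/-- The data of a finite chain of one-step backward extensions of a sequence whose increments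
are, from the second one on, the moments of `ρ`. -/
structure BackwardChain (a : ℕ → ℕ → ℝ) (x : ℕ → ℝ) (ρ : Measure unitInterval) (κ : ℕ) :
    Prop where
  finite : IsFiniteMeasure ρ
  zero : ∀ k ≤ κ, a k 0 = 1
  one : a 0 1 = x 0
  moments : ∀ n, a 0 (n + 2) - a 0 (n + 1) = powMoment ρ n
  step : ∀ k < κ, ∀ n, a (k + 1) (n + 1) = x (k + 1) * a k n
  pos : ∀ k, 0 < x (k + 1)

/-- The product `x₁ ⋯ x_k`. -/
noncomputable def chainWeight (x : ℕ → ℝ) (k : ℕ) : ℝ := ∏ j ∈ Finset.range k, x (j + 1)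

/-- `x₀ - ∫ (s⁻¹ + ⋯ + s^(-k)) dρ(s)`. -/
noncomputable def chainZeta (x : ℕ → ℝ) (ρ : Measure unitInterval) (k : ℕ) : ℝ :=
  x 0 - ∑ j ∈ Finset.range k, (negMoment ρ (j + 1)).toReal

/-- The increments of the `k`-th sequence are, from the second one on, the moments of a
multiple of the measure `s ^ (-k) dρ(s)`. -/
def ChainStage (a : ℕ → ℕ → ℝ) (x : ℕ → ℝ) (ρ : Measure unitInterval) (k : ℕ) : Prop :=
  ∃ σ : Measure unitInterval, IsFiniteMeasure σ ∧
    (∀ n, a k (n + 2) - a k (n + 1) = powMoment σ n) ∧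
    ∀ j, negMoment σ j = ENNReal.ofReal (chainWeight x k) * negMoment ρ (j + k)

/-- The `k`-th sequence can be extended backward. -/
def ChainTight (x : ℕ → ℝ) (ρ : Measure unitInterval) (k : ℕ) : Prop :=
  negMoment ρ (k + 1) < ⊤ ∧ 1 + chainWeight x k * (negMoment ρ (k + 1)).toReal = x k

namespace BackwardChain

theorem weight_pos (h : BackwardChain a x ρ κ) (k : ℕ) : 0 < chainWeight x k := Finset.prod_pos fun j _ => h.pos j

theorem eval_one (h : BackwardChain a x ρ κ) {k : ℕ} (hk : k ≤ κ) : a k 1 = x k := by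
  rcases k with _ | k
  · exact h.one
  · rw [h.step k hk 0, h.zero k (Nat.le_of_succ_le hk), mul_one]

theorem stage_zero (h : BackwardChain a x ρ κ) : ChainStage a x ρ 0 :=
  ⟨ρ, h.finite, h.moments, fun j => by simp [chainWeight]⟩

theorem negMoment_lt_top_of_mul (h : BackwardChain a x ρ κ) {k : ℕ} {q : ℝ≥0∞}
    (hq : ENNReal.ofReal (chainWeight x k) * q < ⊤) : q < ⊤ := by
  rcases ENNReal.mul_lt_top_iff.1 hq with h1 | h1 | h1
  · exact h1.2
  · exact absurd h1 (by simpa using h.weight_pos k)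
  · simp [h1]

theorem le_iff (h : BackwardChain a x ρ κ) {k : ℕ} {q : ℝ≥0∞} {y : ℝ} :
    0 ≤ y ∧ ENNReal.ofReal (chainWeight x k) * q ≤ ENNReal.ofReal y ↔
      q < ⊤ ∧ chainWeight x k * q.toReal ≤ y := by
  have hw := h.weight_pos k
  constructor
  · rintro ⟨hy, hq⟩
    have h1 := h.negMoment_lt_top_of_mul (hq.trans_lt ENNReal.ofReal_lt_top)
    refine ⟨h1, ?_⟩
    rw [← ENNReal.ofReal_toReal h1.ne, ← ENNReal.ofReal_mul hw.le,
      ENNReal.ofReal_le_ofReal_iff hy] at hq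
    exact hq
  · rintro ⟨h1, h2⟩
    have h3 : 0 ≤ chainWeight x k * q.toReal := by positivity
    refine ⟨h3.trans h2, ?_⟩
    rw [← ENNReal.ofReal_toReal h1.ne, ← ENNReal.ofReal_mul hw.le]
    exact ENNReal.ofReal_le_ofReal h2

theorem completelyAlternating_iff_le (h : BackwardChain a x ρ κ) {k : ℕ} (hk : k ≤ κ) (hs : ChainStage a x ρ k) :
    CompletelyAlternating (a k) ↔ negMoment ρ (k + 1) < ⊤ ∧
      1 + chainWeight x k * (negMoment ρ (k + 1)).toReal ≤ x k := by
  obtain ⟨σ, hσ, h1, h2⟩ := hs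
  have h3 : (0 ≤ a k 1 - a k 0 ∧ negMoment σ 1 ≤ ENNReal.ofReal (a k 1 - a k 0)) ↔
      negMoment ρ (k + 1) < ⊤ ∧
        1 + chainWeight x k * (negMoment ρ (k + 1)).toReal ≤ x k := by
    rw [h2, h.le_iff, h.eval_one hk, h.zero k hk, add_comm 1 k, le_sub_iff_add_le,
      add_comm (_ * _)]
  rw [← h3]
  exact ⟨fun h4 => h4.negMoment_le h1,
    fun h4 => (exists_incrementsAreMoments h1 h4.1 h4.2).completelyAlternating⟩

/-- Tightness says that the atom at `0` has mass zero, so the new measure is a pure multiple of `s⁻¹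
dσ` and its inverse moments are again those of `ρ`, shifted. -/
theorem stage_succ (h : BackwardChain a x ρ κ) {k : ℕ} (hk : k < κ) (hs : ChainStage a x ρ k) (ht : ChainTight x ρ k) :
    ChainStage a x ρ (k + 1) := by
  obtain ⟨σ, hσ, h1, h2⟩ := hs
  have hw := h.weight_pos k
  have h3 : negMoment σ 1 = ENNReal.ofReal (a k 1 - a k 0) := by
    rw [h2, h.eval_one hk.le, h.zero k hk.le, ← ht.2, add_sub_cancel_left,
      ENNReal.ofReal_mul hw.le, add_comm 1 k, ENNReal.ofReal_toReal ht.1.ne]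
  have h0 : 0 ≤ a k 1 - a k 0 := by
    rw [h.eval_one hk.le, h.zero k hk.le, ← ht.2, add_sub_cancel_left]
    positivity
  have h4 := exists_incrementsAreMoments h1 h0 h3.le
  rw [h3, tsub_self, zero_smul, add_zero] at h4
  have := h4.1
  refine ⟨ENNReal.ofReal (x (k + 1)) • divMeasure σ, Measure.smul_finite _ ENNReal.ofReal_ne_top, fun n => ?_, fun j => ?_⟩
  · rw [powMoment_ofReal_smul (h.pos k).le, ← h4.2, h.step k hk, h.step k hk]
    ring
  · rw [negMoment_smul, negMoment_divMeasure, h2, ← mul_assoc,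
      ← ENNReal.ofReal_mul (h.pos k).le, chainWeight, chainWeight, Finset.prod_range_succ,
      mul_comm (x (k + 1)), add_assoc, add_comm 1 k]

/-- The inequality at stage `k` comes from the first sequence. The next sequence forces a finite
inverse moment of the extended measure, hence no atom at `0` and no slack. -/
theorem tight_of_completelyAlternating (h : BackwardChain a x ρ κ) {k : ℕ} (hk : k < κ) (hs : ChainStage a x ρ k)
    (hca : CompletelyAlternating (a k)) (hca' : CompletelyAlternating (a (k + 1))) :
    ChainTight x ρ k := by
  have hle := (h.completelyAlternating_iff_le hk.le hs).1 hca
  refine ⟨hle.1, le_antisymm hle.2 ?_⟩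
  obtain ⟨σ, hσ, h1, h2⟩ := hs
  have h3 := hca.negMoment_le h1
  have h4 := exists_incrementsAreMoments h1 h3.1 h3.2
  have hfin := h4.1
  have := Measure.smul_finite (divMeasure σ +
    (ENNReal.ofReal (a k 1 - a k 0) - negMoment σ 1) • Measure.dirac (0 : unitInterval))
    (ENNReal.ofReal_ne_top (r := x (k + 1)))
  -- The later increments of the sequence `k + 1` are moments of `x (k + 1)` times the measure found
  -- for the sequence `k`, atom included.
  have h5 := (hca'.negMoment_le
    (ρ := ENNReal.ofReal (x (k + 1)) • (divMeasure σ +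
      (ENNReal.ofReal (a k 1 - a k 0) - negMoment σ 1) • Measure.dirac (0 : unitInterval)))
    fun n => by
      rw [powMoment_ofReal_smul (h.pos k).le, ← h4.2, h.step k hk, h.step k hk]
      ring).2.trans_lt ENNReal.ofReal_lt_top
  rw [negMoment_smul] at h5
  have h6 := negMoment_add_dirac_lt_top
    ((ENNReal.mul_lt_top_iff.1 h5).elim (fun h => h.2) fun h' => h'.elim
      (fun h' => absurd h' (by simpa using h.pos k)) fun h' => by simp [h'])
  have h7 := tsub_eq_zero_iff_le.1 h6
  rw [h2, h.eval_one hk.le, h.zero k hk.le, add_comm 1 k, ← ENNReal.ofReal_toReal hle.1.ne,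
    ← ENNReal.ofReal_mul (h.weight_pos k).le, ENNReal.ofReal_le_ofReal_iff
      (mul_nonneg (h.weight_pos k).le ENNReal.toReal_nonneg)] at h7
  linarith

/-- Passing from `ζ_k` to `ζ_{k+1}` subtracts one inverse moment, and the preceding equation turns
`w_k ζ_k` into `x_k`. This converts the one-step conditions into conditions on the `ζ`'s. -/
theorem weight_mul_zeta {k : ℕ} (hz : ∀ j < k, chainWeight x j * chainZeta x ρ (j + 1) = 1) :
    chainWeight x k * chainZeta x ρ (k + 1) =
      x k - chainWeight x k * (negMoment ρ (k + 1)).toReal := by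
  rcases k with _ | k
  · simp [chainWeight, chainZeta]
  · have h1 := hz k (by omega)
    have h2 : chainZeta x ρ (k + 1 + 1) =
        chainZeta x ρ (k + 1) - (negMoment ρ (k + 1 + 1)).toReal := by
      rw [chainZeta, Finset.sum_range_succ, ← sub_sub]
      rfl
    have h3 : chainWeight x (k + 1) = chainWeight x k * x (k + 1) := by
      rw [chainWeight, Finset.prod_range_succ]
      rfl
    rw [h2, h3]
    linear_combination x (k + 1) * h1

theorem tight_iff {k : ℕ} (hf : ∀ j < k, negMoment ρ (j + 1) < ⊤) :
    (∀ j < k, ChainTight x ρ j) ↔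
      ∀ j < k, chainWeight x j * chainZeta x ρ (j + 1) = 1 := by
  constructor
  · intro ht j hj
    induction j using Nat.strong_induction_on with
    | _ j ih =>
      rw [weight_mul_zeta fun i hi => ih i hi (hi.trans hj)]
      linarith [(ht j hj).2]
  · intro hz j hj
    have := weight_mul_zeta fun i hi => hz i (hi.trans hj)
    refine ⟨hf j hj, ?_⟩
    linarith [hz j hj]

/-- All sequences of the chain are completely alternating if and only if the sums
`ζ_{k+1}` are the reciprocals of the products of the weights, with an inequality for the last. -/
theorem completelyAlternating_iff_zeta (h : BackwardChain a x ρ κ) :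
    (∀ k ≤ κ, CompletelyAlternating (a k)) ↔ (∀ k ≤ κ, negMoment ρ (k + 1) < ⊤) ∧
      (∀ k < κ, chainWeight x k * chainZeta x ρ (k + 1) = 1) ∧
      1 ≤ chainWeight x κ * chainZeta x ρ (κ + 1) := by
  constructor
  · intro hca
    have hst : ∀ k ≤ κ, ChainStage a x ρ k := by
      intro k
      induction k with
      | zero => exact fun _ => h.stage_zero
      | succ k ih =>
        exact fun hk => h.stage_succ hk (ih (by omega))
          (h.tight_of_completelyAlternating hk (ih (by omega)) (hca k (by omega)) (hca _ hk))
    have ht : ∀ k < κ, ChainTight x ρ k := fun k hk =>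
      h.tight_of_completelyAlternating hk (hst k hk.le) (hca k hk.le) (hca (k + 1) hk)
    have hf : ∀ k ≤ κ, negMoment ρ (k + 1) < ⊤ := fun k hk =>
      ((h.completelyAlternating_iff_le hk (hst k hk)).1 (hca k hk)).1
    have hz := (tight_iff fun j hj => hf j hj.le).1 ht
    refine ⟨hf, hz, ?_⟩
    rw [weight_mul_zeta hz]
    linarith [((h.completelyAlternating_iff_le le_rfl (hst κ le_rfl)).1 (hca κ le_rfl)).2]
  · rintro ⟨hf, hz, hl⟩
    have ht := (tight_iff fun j hj => hf j hj.le).2 hz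
    have hst : ∀ k ≤ κ, ChainStage a x ρ k := by
      intro k
      induction k with
      | zero => exact fun _ => h.stage_zero
      | succ k ih =>
        exact fun hk => h.stage_succ hk (ih (by omega)) (ht k hk)
    intro k hk
    rw [h.completelyAlternating_iff_le hk (hst k hk)]
    refine ⟨hf k hk, ?_⟩
    rcases hk.lt_or_eq with hk | rfl
    · exact (ht k hk).2.le
    · rw [weight_mul_zeta hz] at hl
      linarith

end BackwardChain

end Chain

/-! ### Bounded weighted shifts on directed trees -/

theorem Ell2.enorm_sq {V : Type*} (f : Ell2 V) : ‖f‖ₑ ^ 2 = ∑' u, ‖f u‖ₑ ^ 2 := by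
  have h := lp.hasSum_norm (p := 2) (by norm_num) f
  simp only [ENNReal.toReal_ofNat, Real.rpow_ofNat] at h
  have h1 := ENNReal.ofReal_tsum_of_nonneg (fun u => sq_nonneg ‖f u‖) h.summable
  rw [h.tsum_eq] at h1
  simpa only [ENNReal.ofReal_pow (norm_nonneg _), ofReal_norm] using h1

theorem memℓp_two_iff {V : Type*} (f : V → ℂ) :
    Memℓp (E := fun _ : V => ℂ) f 2 ↔ ∑' u, ‖f u‖ₑ ^ 2 ≠ ⊤ := by
  rw [memℓp_gen_iff (by norm_num)]
  simp only [ENNReal.toReal_ofNat, Real.rpow_ofNat]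
  constructor
  · intro h
    have h1 := ENNReal.ofReal_tsum_of_nonneg (fun u => sq_nonneg ‖f u‖) h
    simp only [ENNReal.ofReal_pow (norm_nonneg _), ofReal_norm] at h1
    exact h1 ▸ ENNReal.ofReal_ne_top
  · intro h
    simpa using ENNReal.summable_toReal h

theorem basisVec_apply_self {V : Type*} (u : V) : basisVec u u = 1 := by
  simp [basisVec]

theorem basisVec_apply_of_ne {V : Type*} {u v : V} (h : v ≠ u) : basisVec u v = 0 := by
  simp [basisVec, h]

namespace DirectedTree

variable {V : Type*} (T : DirectedTree V)

theorem pa_adj (v : T.NonRoot) : T.Adj (T.pa v) v := v.2.choose_spec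

theorem pa_eq {u v : V} (h : T.Adj u v) : T.pa ⟨v, u, h⟩ = u :=
  T.parent_unique _ _ _ (T.pa_adj _) h

open Classical in
/-- The sum of `|λ_v|² c(v)` over all children `v` of `u`. -/
noncomputable def childSum (lam : T.NonRoot → ℂ) (c : V → ℝ≥0∞) (u : V) : ℝ≥0∞ :=
  ∑' v : T.NonRoot, if T.pa v = u then ‖lam v‖ₑ ^ 2 * c v else 0

/-- The squared norms `‖S_λ ^ n e_u‖²`, defined by recursion over the children of `u`. -/
noncomputable def orbitNorm (lam : T.NonRoot → ℂ) : ℕ → V → ℝ≥0∞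
  | 0 => 1
  | n + 1 => T.childSum lam (orbitNorm lam n)

theorem childSum_eq_single (lam : T.NonRoot → ℂ) (c : V → ℝ≥0∞) {u v : V} (h : T.Adj u v)
    (hv : ∀ w, T.Adj u w → w = v) :
    T.childSum lam c u = ‖lam ⟨v, u, h⟩‖ₑ ^ 2 * c v := by
  unfold childSum
  rw [tsum_eq_single ⟨v, u, h⟩]
  · rw [if_pos (T.pa_eq h)]
  · intro w hw
    refine if_neg fun hu => hw (Subtype.ext (hv w ?_))
    exact hu ▸ T.pa_adj w

theorem childSum_eq_tsum (lam : T.NonRoot → ℂ) (c : V → ℝ≥0∞) {u : V} {ι : Type*}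
    {f : ι → T.NonRoot} (hf : Function.Injective f) (h : ∀ i, T.Adj u (f i))
    (hv : ∀ w : T.NonRoot, T.Adj u w → w ∈ Set.range f) :
    T.childSum lam c u = ∑' i, ‖lam (f i)‖ₑ ^ 2 * c (f i) := by
  classical
  unfold childSum
  rw [← hf.tsum_eq]
  · exact tsum_congr fun i => if_pos (T.pa_eq (h i))
  · intro w hw
    by_contra hw'
    refine hw (if_neg fun hu => hw' (hv w ?_))
    exact hu ▸ T.pa_adj w

theorem shiftMap_apply (lam : T.NonRoot → ℂ) (f : V → ℂ) (v : T.NonRoot) :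
    T.shiftMap lam f v = lam v * f (T.pa v) := by
  simp only [shiftMap, LinearMap.coe_mk, AddHom.coe_mk]
  rw [dif_pos v.2]

/-- The sum over vertices is regrouped by parents; roots contribute nothing. Iterating with `c` an
orbit norm diagonalizes `‖(A ^ n) f‖²`. -/
theorem tsum_shiftMap (lam : T.NonRoot → ℂ) (f : V → ℂ) (c : V → ℝ≥0∞) :
    ∑' v, ‖T.shiftMap lam f v‖ₑ ^ 2 * c v = ∑' u, ‖f u‖ₑ ^ 2 * T.childSum lam c u := by
  classical
  have h1 : ∑' v : T.NonRoot, ‖T.shiftMap lam f v‖ₑ ^ 2 * c v =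
      ∑' v, ‖T.shiftMap lam f v‖ₑ ^ 2 * c v := by
    refine Subtype.val_injective.tsum_eq (f := fun v => ‖T.shiftMap lam f v‖ₑ ^ 2 * c v) ?_
    intro v hv
    by_contra h
    refine hv ?_
    have h2 : ¬ ∃ u, T.Adj u v := fun h' => h ⟨⟨v, h'⟩, rfl⟩
    simp [shiftMap, h2]
  rw [← h1]
  unfold childSum
  simp only [← ENNReal.tsum_mul_left]
  rw [ENNReal.tsum_comm]
  refine tsum_congr fun v => ?_
  rw [tsum_eq_single (T.pa v), if_pos rfl, shiftMap_apply, enorm_mul]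
  · ring
  · intro u hu
    rw [if_neg hu.symm, mul_zero]

variable {T} {lam lam' : T.NonRoot → ℂ} {A B : Ell2 V →L[ℂ] Ell2 V}

theorem IsShift.apply (h : T.IsShift lam A) (f : Ell2 V) (v : V) :
    A f v = T.shiftMap lam (fun u => f u) v := by
  obtain ⟨h1, h2⟩ := LinearPMap.ext_iff.1 h
  have hf : f ∈ (T.weightedShift lam).domain := h1 ▸ Submodule.mem_top
  have h3 := h2 (x := f) (hf := hf) (hg := Submodule.mem_top)
  have h4 : T.weightedShift lam ⟨f, hf⟩ = A f := h3
  rw [← h4]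
  rfl

theorem IsShift.enorm_pow_sq (h : T.IsShift lam A) (n : ℕ) (f : Ell2 V) :
    ‖(A ^ n) f‖ₑ ^ 2 = ∑' u, ‖f u‖ₑ ^ 2 * T.orbitNorm lam n u := by
  induction n generalizing f with
  | zero => simp [orbitNorm, Ell2.enorm_sq]
  | succ n ih =>
    have h1 : (A ^ (n + 1)) f = (A ^ n) (A f) := by
      rw [_root_.pow_succ]
      rfl
    rw [h1, ih, orbitNorm, ← T.tsum_shiftMap]
    simp only [h.apply]

theorem IsShift.orbitNorm_eq (h : T.IsShift lam A) (n : ℕ) (u : V) :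
    T.orbitNorm lam n u = ‖(A ^ n) (basisVec u)‖ₑ ^ 2 := by
  rw [h.enorm_pow_sq, tsum_eq_single u, basisVec_apply_self]
  · simp
  · intro v hv
    simp [basisVec_apply_of_ne hv]

theorem IsShift.toReal_orbitNorm (h : T.IsShift lam A) (n : ℕ) (u : V) :
    (T.orbitNorm lam n u).toReal = ‖(A ^ n) (basisVec u)‖ ^ 2 := by
  rw [h.orbitNorm_eq]
  simp

theorem IsShift.orbitNorm_ne_top (h : T.IsShift lam A) (n : ℕ) (u : V) :
    T.orbitNorm lam n u ≠ ⊤ := by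
  rw [h.orbitNorm_eq]
  simp

theorem IsShift.hasSum (h : T.IsShift lam A) (n : ℕ) (f : Ell2 V) :
    HasSum (fun u => ‖f u‖ ^ 2 * ‖(A ^ n) (basisVec u)‖ ^ 2) (‖(A ^ n) f‖ ^ 2) := by
  have h1 := h.enorm_pow_sq n f
  have h2 : ∑' u, ‖f u‖ₑ ^ 2 * T.orbitNorm lam n u ≠ ⊤ := by
    rw [← h1]
    simp
  have h3 := (ENNReal.summable_toReal h2).hasSum
  rw [← ENNReal.tsum_toReal_eq (ENNReal.ne_top_of_tsum_ne_top h2), ← h1] at h3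
  simpa [h.toReal_orbitNorm] using h3

/-- A bounded weighted shift is completely hyperexpansive if and only if it is so on the
standard basis. -/
theorem IsShift.completelyHyperexpansive_iff (h : T.IsShift lam A) :
    CompletelyHyperexpansive A ↔
      ∀ u, CompletelyAlternating fun n => ‖(A ^ n) (basisVec u)‖ ^ 2 := by
  refine ⟨fun hA u => hA (basisVec u), fun hu f m n hn => ?_⟩
  -- The alternating sum for `f` is the sum over `u` of `‖f u‖ ^ 2` times the one for `basisVec u`.
  have h1 := hasSum_sum (s := Finset.range (n + 1)) fun j _ =>
    (h.hasSum (m + j) f).mul_left ((-1 : ℝ) ^ j * (n.choose j : ℝ))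
  rw [← h1.tsum_eq]
  refine tsum_nonpos fun u => ?_
  have h2 := mul_nonpos_of_nonneg_of_nonpos (sq_nonneg ‖f u‖) (hu u m n hn)
  rw [Finset.mul_sum] at h2
  refine le_of_eq_of_le (Finset.sum_congr rfl fun j _ => ?_) h2
  ring

/-- `childSum lam 1 u` plays the role of `‖S_λ e_u‖²`, and a uniform bound on it bounds the whole
operator by orthogonality. -/
theorem exists_isShift {C : ℝ≥0∞} (hC : C ≠ ⊤) (h : ∀ u, T.childSum lam 1 u ≤ C) :
    ∃ A, T.IsShift lam A := by
  have hle : ∀ f : Ell2 V, ∑' v, ‖T.shiftMap lam (fun u => f u) v‖ₑ ^ 2 ≤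
      C * ‖f‖ₑ ^ 2 := by
    intro f
    have h1 := T.tsum_shiftMap lam (fun u => f u) 1
    simp only [Pi.one_apply, mul_one] at h1
    rw [h1, Ell2.enorm_sq, ← ENNReal.tsum_mul_left]
    refine ENNReal.tsum_le_tsum fun u => ?_
    rw [mul_comm]
    gcongr
    exact h u
  have hdom : ∀ f : Ell2 V, f ∈ (T.weightedShift lam).domain := by
    intro f
    refine (memℓp_two_iff _).2 ((hle f).trans_lt ?_).ne
    exact ENNReal.mul_lt_top hC.lt_top (by simp)
  let L : Ell2 V →ₗ[ℂ] Ell2 V :=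
    { toFun := fun f => T.weightedShift lam ⟨f, hdom f⟩
      map_add' := fun f g => (T.weightedShift lam).map_add ⟨f, hdom f⟩ ⟨g, hdom g⟩
      map_smul' := fun c f => (T.weightedShift lam).map_smul c ⟨f, hdom f⟩ }
  refine ⟨L.mkContinuous (Real.sqrt C.toReal) fun f => ?_, ?_⟩
  · have h1 : ‖L f‖ₑ ^ 2 ≤ C * ‖f‖ₑ ^ 2 := by
      rw [Ell2.enorm_sq]
      exact hle f
    have h2 := ENNReal.toReal_mono (ENNReal.mul_ne_top hC (by simp)) h1
    simp only [ENNReal.toReal_mul, ENNReal.toReal_pow, toReal_enorm] at h2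
    refine le_of_sq_le_sq ?_ (by positivity)
    rwa [mul_pow, Real.sq_sqrt ENNReal.toReal_nonneg]
  · refine LinearPMap.ext ?_ ?_
    · exact Submodule.ext fun f => ⟨fun _ => Submodule.mem_top, fun _ => hdom f⟩
    · intro f _ _
      rfl

theorem IsShift.weight_eq (h : T.IsShift lam A) (v : T.NonRoot) :
    lam v = A (basisVec (T.pa v)) v := by
  rw [h.apply, shiftMap_apply, basisVec_apply_self, mul_one]

/-- The weights of a bounded weighted shift are determined by the operator. -/
theorem IsShift.weights_unique (h : T.IsShift lam A) (h' : T.IsShift lam' B)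
    (heq : T.weightedShift lam = T.weightedShift lam') : lam = lam' := by
  have h1 : (A : Ell2 V →ₗ[ℂ] Ell2 V).toPMap ⊤ = (B : Ell2 V →ₗ[ℂ] Ell2 V).toPMap ⊤ := by
    rw [← h, ← h', heq]
  have h2 : ∀ f, A f = B f := fun f =>
    (LinearPMap.ext_iff.1 h1).2 (x := f) (hf := Submodule.mem_top) (hg := Submodule.mem_top)
  funext v
  rw [h.weight_eq, h'.weight_eq, h2]

end DirectedTree

/-! ### Weighted shifts on the tree with one branching vertex -/

section OneBranching

variable {η : ℕ∞} {κ : ℕ}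

/-- The vertex `(i, j + 1)` as a vertex different from the root. -/
def rayNode (i : JSet η) (j : ℕ) : (tree η κ).NonRoot :=
  ⟨.ray i j, by
    cases j with
    | zero => exact ⟨_, .branch i⟩
    | succ j => exact ⟨_, .ray i j⟩⟩

/-- The vertex `-k`, for `k < κ`, as a vertex different from the root. -/
def trunkNode (k : ℕ) (hk : k < κ) : (tree η κ).NonRoot :=
  ⟨.trunk k hk.le, _, .trunk k hk⟩

theorem nonRoot_cases (v : (tree η κ).NonRoot) :
    (∃ i j, v = rayNode i j) ∨ ∃ k hk, v = trunkNode k hk := by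
  obtain ⟨v, u, h⟩ := v
  cases h with
  | trunk k hk => exact .inr ⟨k, hk, rfl⟩
  | branch i => exact .inl ⟨i, 0, rfl⟩
  | ray i j => exact .inl ⟨i, j + 1, rfl⟩

theorem rayNode_ne_trunkNode (i : JSet η) (j k : ℕ) (hk : k < κ) :
    rayNode i j ≠ trunkNode k hk := by
  intro h
  have h1 := congrArg Subtype.val h
  simp [rayNode, trunkNode] at h1

theorem trunkNode_ne_trunkNode {k l : ℕ} (hk : k < κ) (hl : l < κ) (h : k ≠ l) :
    trunkNode (η := η) k hk ≠ trunkNode l hl := by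
  intro h'
  have h1 := congrArg Subtype.val h'
  simp [trunkNode] at h1
  exact h h1

variable (lam : (tree η κ).NonRoot → ℂ)

theorem childSum_ray (c : Vertex η κ → ℝ≥0∞) (i : JSet η) (j : ℕ) :
    (tree η κ).childSum lam c (.ray i j) =
      ‖lam (rayNode i (j + 1))‖ₑ ^ 2 * c (.ray i (j + 1)) :=
  (tree η κ).childSum_eq_single lam c (Edge.ray i j) fun _ hw => by cases hw; rfl

theorem childSum_trunk_succ (c : Vertex η κ → ℝ≥0∞) (k : ℕ) (hk : k < κ) :
    (tree η κ).childSum lam c (.trunk (k + 1) hk) =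
      ‖lam (trunkNode k hk)‖ₑ ^ 2 * c (.trunk k hk.le) :=
  (tree η κ).childSum_eq_single lam c (Edge.trunk k hk) fun _ hw => by cases hw; rfl

theorem childSum_trunk_zero (c : Vertex η κ → ℝ≥0∞) :
    (tree η κ).childSum lam c (.trunk 0 κ.zero_le) =
      ∑' i, ‖lam (branchChild i)‖ₑ ^ 2 * c (.ray i 0) := by
  refine (tree η κ).childSum_eq_tsum lam c (f := branchChild) ?_ (fun i => Edge.branch i) ?_
  · intro i i' h
    have h1 := congrArg Subtype.val h
    simpa [branchChild] using h1
  · rintro ⟨w, hw⟩ hw'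
    cases hw' with
    | branch i => exact ⟨i, rfl⟩

theorem orbitNorm_ray_add (i : JSet η) (j n l : ℕ) :
    (tree η κ).orbitNorm lam (j + n) (.ray i l) =
      (tree η κ).orbitNorm lam j (.ray i l) * (tree η κ).orbitNorm lam n (.ray i (l + j)) := by
  induction j generalizing l with
  | zero => simp [DirectedTree.orbitNorm]
  | succ j ih =>
    rw [Nat.succ_add, DirectedTree.orbitNorm, DirectedTree.orbitNorm, childSum_ray,
      childSum_ray, ih, mul_assoc, Nat.add_right_comm, add_assoc l j 1]

variable {lam} {A : Ell2 (Vertex η κ) →L[ℂ] Ell2 (Vertex η κ)}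

theorem norm_pow_ray_add (h : (tree η κ).IsShift lam A) (i : JSet η) (j n l : ℕ) :
    ‖(A ^ (j + n)) (basisVec (.ray i l))‖ ^ 2 =
      ‖(A ^ j) (basisVec (.ray i l))‖ ^ 2 * ‖(A ^ n) (basisVec (.ray i (l + j)))‖ ^ 2 := by
  simp only [← h.toReal_orbitNorm]
  rw [orbitNorm_ray_add, ENNReal.toReal_mul]

theorem norm_pow_zero_basisVec (u : Vertex η κ) : ‖(A ^ 0) (basisVec u)‖ ^ 2 = 1 := by
  classical
  have h1 : ‖basisVec u‖ = 1 := by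
    rw [basisVec, lp.norm_single (by norm_num)]
    simp
  simp [h1]

theorem norm_pow_ray_succ (h : (tree η κ).IsShift lam A) (i : JSet η) (n : ℕ) :
    ‖(A ^ (n + 1)) (basisVec (.ray i 0))‖ ^ 2 =
      ‖(A ^ n) (basisVec (.ray i 0))‖ ^ 2 * ‖lam (rayNode i (n + 1))‖ ^ 2 := by
  rw [norm_pow_ray_add h, ← h.toReal_orbitNorm 1, DirectedTree.orbitNorm, childSum_ray]
  simp [DirectedTree.orbitNorm]

theorem norm_pow_trunk_succ (h : (tree η κ).IsShift lam A) (k : ℕ) (hk : k < κ) (n : ℕ) :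
    ‖(A ^ (n + 1)) (basisVec (.trunk (k + 1) hk))‖ ^ 2 =
      ‖lam (trunkNode k hk)‖ ^ 2 * ‖(A ^ n) (basisVec (.trunk k hk.le))‖ ^ 2 := by
  simp only [← h.toReal_orbitNorm]
  rw [DirectedTree.orbitNorm, childSum_trunk_succ]
  simp

theorem norm_ray_pos (h : (tree η κ).IsShift lam A) (hlam : ∀ v, lam v ≠ 0) (i : JSet η)
    (n : ℕ) : 0 < ‖(A ^ n) (basisVec (.ray i 0))‖ ^ 2 := by
  induction n with
  | zero =>
    rw [norm_pow_zero_basisVec]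
    exact one_pos
  | succ n ih =>
    rw [norm_pow_ray_succ h]
    exact mul_pos ih (pow_pos (norm_pos_iff.2 (hlam _)) 2)

theorem norm_apply_root (h : (tree η κ).IsShift lam A) (hκ : 1 ≤ κ) :
    ‖A (basisVec (rootVertex η κ))‖ = ‖lam (rootChild η hκ)‖ := by
  obtain ⟨k, rfl⟩ : ∃ k, κ = k + 1 := ⟨κ - 1, by omega⟩
  have h1 := norm_pow_trunk_succ h k k.lt_succ_self 0
  rw [norm_pow_zero_basisVec, mul_one, zero_add, pow_one] at h1
  exact (pow_left_inj₀ (norm_nonneg _) (norm_nonneg _) two_ne_zero).1 h1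

/-- The condition that the `i`-th ray has the representing measure `τ_i`, in terms of weights. -/
theorem isRepresentingMeasure_ray_iff (h : (tree η κ).IsShift lam A)
    (τ : JSet η → Measure unitInterval) (i : JSet η) [IsFiniteMeasure (τ i)] :
    IsRepresentingMeasure (τ i) (fun n => ‖(A ^ n) (basisVec (.ray i 0))‖ ^ 2) ↔
      ∀ j, ‖lam (rayNode i (j + 1))‖ =
        Real.sqrt ((1 + geomIntegral (τ i) (j + 1)) / (1 + geomIntegral (τ i) j)) := by
  have hg : ∀ j, 0 < 1 + geomIntegral (τ i) j := fun j => by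
    linarith [geomIntegral_nonneg (τ i) j]
  have h1 : IsRepresentingMeasure (τ i) (fun n => ‖(A ^ n) (basisVec (.ray i 0))‖ ^ 2) ↔
      ∀ n, ‖(A ^ n) (basisVec (.ray i 0))‖ ^ 2 = 1 + geomIntegral (τ i) n := by
    unfold IsRepresentingMeasure
    simp only [norm_pow_zero_basisVec]
    refine ⟨fun h2 n => ?_, fun h2 => ⟨inferInstance, fun n _ => h2 n⟩⟩
    rcases n with _ | n
    · rw [norm_pow_zero_basisVec, geomIntegral_zero, add_zero]
    · exact h2.2 _ (by omega)
  rw [h1]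
  constructor
  · intro h2 j
    have h3 := norm_pow_ray_succ h i j
    rw [h2, h2] at h3
    rw [h3, mul_div_cancel_left₀ _ (hg j).ne', Real.sqrt_sq (norm_nonneg _)]
  · intro h2 n
    induction n with
    | zero => rw [norm_pow_zero_basisVec, geomIntegral_zero, add_zero]
    | succ n ih =>
      rw [norm_pow_ray_succ h, ih, h2, Real.sq_sqrt (div_nonneg (hg _).le (hg _).le),
        mul_div_cancel₀ _ (hg n).ne']

/-- The measure `∑ᵢ tᵢ² τᵢ`. -/
noncomputable def branchMeasure (τ : JSet η → Measure unitInterval) (t : JSet η → ℝ) :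
    Measure unitInterval :=
  Measure.sum fun i => ENNReal.ofReal (t i ^ 2) • τ i

theorem lintegral_branchMeasure (τ : JSet η → Measure unitInterval) (t : JSet η → ℝ)
    (f : unitInterval → ℝ≥0∞) :
    ∫⁻ s, f s ∂branchMeasure τ t = ∑' i, ENNReal.ofReal (t i ^ 2) * ∫⁻ s, f s ∂τ i := by
  simp [branchMeasure, lintegral_sum_measure, lintegral_smul_measure]

theorem isFiniteMeasure_branchMeasure {τ : JSet η → Measure unitInterval}
    (hτ : (⨆ i, τ i Set.univ) < ⊤) {t : JSet η → ℝ}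
    (ht : ∑' i, ENNReal.ofReal (t i ^ 2) < ⊤) : IsFiniteMeasure (branchMeasure τ t) := by
  refine ⟨?_⟩
  have h1 := lintegral_branchMeasure τ t 1
  simp only [Pi.one_apply, lintegral_one] at h1
  rw [h1]
  refine lt_of_le_of_lt (ENNReal.tsum_le_tsum fun i => ?_)
    (b := ∑' i, ENNReal.ofReal (t i ^ 2) * ⨆ i, τ i Set.univ) ?_
  · gcongr
    exact le_iSup (fun i => τ i Set.univ) i
  · rw [ENNReal.tsum_mul_right]
    exact ENNReal.mul_lt_top ht hτ

theorem isFiniteMeasure_of_iSup {τ : JSet η → Measure unitInterval}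
    (hτ : (⨆ i, τ i Set.univ) < ⊤) (i : JSet η) : IsFiniteMeasure (τ i) :=
  ⟨(le_iSup (fun i => τ i Set.univ) i).trans_lt hτ⟩

theorem tsum_mul_invMoment (τ : JSet η → Measure unitInterval) (t : JSet η → ℝ) (k : ℕ) :
    ∑' i, ENNReal.ofReal (t i ^ 2) * invMoment (τ i) k =
      ∑ j ∈ Finset.range k, negMoment (branchMeasure τ t) (j + 1) := by
  have h1 : invMoment (branchMeasure τ t) k =
      ∑' i, ENNReal.ofReal (t i ^ 2) * invMoment (τ i) k := lintegral_branchMeasure _ _ _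
  rw [← h1, invMoment_eq_sum, ← Finset.Ico_add_one_right_eq_Icc, Finset.sum_Ico_eq_sum_range]
  simp only [Nat.add_sub_cancel, add_comm 1]

theorem ofReal_norm_sq (z : ℂ) : ENNReal.ofReal (‖z‖ ^ 2) = ‖z‖ₑ ^ 2 := by
  rw [ENNReal.ofReal_pow (norm_nonneg _), ofReal_norm]

theorem tsum_branch_lt_top (h : (tree η κ).IsShift lam A) :
    ∑' i, ENNReal.ofReal (‖lam (branchChild i)‖ ^ 2) < ⊤ := by
  have h1 := h.orbitNorm_ne_top 1 (.trunk 0 κ.zero_le)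
  rw [DirectedTree.orbitNorm, childSum_trunk_zero] at h1
  simpa [DirectedTree.orbitNorm, ofReal_norm_sq] using h1.lt_top

/-- The squared moduli of the weights along the trunk, preceded by `∑ᵢ |λ_{i,1}|²`. -/
noncomputable def trunkSq (lam : (tree η κ).NonRoot → ℂ) : ℕ → ℝ
  | 0 => (∑' i, ENNReal.ofReal (‖lam (branchChild i)‖ ^ 2)).toReal
  | k + 1 => if hk : k < κ then ‖lam (trunkNode k hk)‖ ^ 2 else 1

/-- One step from `0` spreads over the rays, so increment `n + 1` at `0` is the weighted sum of the
increments `n` at the `(i, 1)`. Sums stay in `[0, ∞]` until the final subtraction. -/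
theorem trunk_moments (h : (tree η κ).IsShift lam A) {τ : JSet η → Measure unitInterval}
    (hrep : ∀ i, IsRepresentingMeasure (τ i) fun n => ‖(A ^ n) (basisVec (.ray i 0))‖ ^ 2)
    (n : ℕ) :
    ‖(A ^ (n + 2)) (basisVec (.trunk 0 κ.zero_le))‖ ^ 2 -
      ‖(A ^ (n + 1)) (basisVec (.trunk 0 κ.zero_le))‖ ^ 2 =
    powMoment (branchMeasure τ fun i => ‖lam (branchChild i)‖) n := by
  have hstep : ∀ i, (tree η κ).orbitNorm lam (n + 1) (.ray i 0) =
      (tree η κ).orbitNorm lam n (.ray i 0) + ∫⁻ s, ENNReal.ofReal (s : ℝ) ^ n ∂τ i := by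
    intro i
    have h1 := (isRepresentingMeasure_iff _ _).1 (hrep i)
    have hfin := h1.1
    have h2 := h1.2 n
    have h4 : ∫⁻ s, ENNReal.ofReal (s : ℝ) ^ n ∂τ i = ENNReal.ofReal (powMoment (τ i) n) := by
      rw [powMoment, ofReal_integral_eq_lintegral_ofReal
        (integrable_of_continuous_unitInterval _ (by fun_prop))
        (.of_forall fun s => pow_nonneg s.2.1 _)]
      exact lintegral_congr fun s => (ENNReal.ofReal_pow s.2.1 n).symm
    simp only [← h.toReal_orbitNorm] at h2
    -- Nonnegativity keeps `ENNReal.ofReal` from truncating the difference.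
    have h5 : 0 ≤ ((tree η κ).orbitNorm lam (n + 1) (.ray i 0)).toReal -
        ((tree η κ).orbitNorm lam n (.ray i 0)).toReal := h2 ▸ powMoment_nonneg _ _
    rw [h4, ← h2]
    refine (ENNReal.toReal_eq_toReal_iff' (h.orbitNorm_ne_top _ _)
      (ENNReal.add_ne_top.2 ⟨h.orbitNorm_ne_top _ _, ENNReal.ofReal_ne_top⟩)).1 ?_
    rw [ENNReal.toReal_add (h.orbitNorm_ne_top _ _) ENNReal.ofReal_ne_top,
      ENNReal.toReal_ofReal h5, add_sub_cancel]
  have h3 : (tree η κ).orbitNorm lam (n + 2) (.trunk 0 κ.zero_le) =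
      (tree η κ).orbitNorm lam (n + 1) (.trunk 0 κ.zero_le) +
        ∫⁻ s, ENNReal.ofReal (s : ℝ) ^ n ∂branchMeasure τ fun i => ‖lam (branchChild i)‖ := by
    rw [lintegral_branchMeasure, DirectedTree.orbitNorm, childSum_trunk_zero,
      DirectedTree.orbitNorm, childSum_trunk_zero, ← ENNReal.tsum_add]
    refine tsum_congr fun i => ?_
    have h6 := hstep i
    rw [DirectedTree.orbitNorm] at h6
    rw [h6, mul_add, ofReal_norm_sq]
  have h5 := h.orbitNorm_ne_top (n + 2) (.trunk 0 κ.zero_le)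
  rw [powMoment_eq_lintegral]
  simp only [← h.toReal_orbitNorm]
  rw [h3] at h5 ⊢
  rw [ENNReal.toReal_add (h.orbitNorm_ne_top _ _) (ENNReal.add_ne_top.1 h5).2]
  ring

open Classical in
theorem backwardChain_trunk (h : (tree η κ).IsShift lam A) (hlam : ∀ v, lam v ≠ 0)
    {τ : JSet η → Measure unitInterval} (hτ : (⨆ i, τ i Set.univ) < ⊤)
    (hrep : ∀ i, IsRepresentingMeasure (τ i) fun n => ‖(A ^ n) (basisVec (.ray i 0))‖ ^ 2) :
    BackwardChain (fun k n => if hk : k ≤ κ then ‖(A ^ n) (basisVec (.trunk k hk))‖ ^ 2 else 0)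
      (trunkSq lam) (branchMeasure τ fun i => ‖lam (branchChild i)‖) κ where
  finite := isFiniteMeasure_branchMeasure hτ (tsum_branch_lt_top h)
  zero k hk := by simp only [dif_pos hk, norm_pow_zero_basisVec]
  one := by
    simp only [dif_pos κ.zero_le]
    rw [← h.toReal_orbitNorm, DirectedTree.orbitNorm, childSum_trunk_zero]
    simp [DirectedTree.orbitNorm, trunkSq]
  moments n := by
    simp only [dif_pos κ.zero_le]
    exact trunk_moments h hrep n
  step k hk n := by
    simp only [dif_pos hk.le, dif_pos (show k + 1 ≤ κ from hk), trunkSq, dif_pos hk]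
    exact norm_pow_trunk_succ h k hk n
  -- Beyond the trunk `trunkSq` has the value `1`, so positivity holds for every index.
  pos k := by
    simp only [trunkSq]
    split_ifs
    · exact pow_pos (norm_pos_iff.2 (hlam _)) 2
    · exact one_pos

theorem completelyHyperexpansive_iff_zeta (h : (tree η κ).IsShift lam A) (hlam : ∀ v, lam v ≠ 0)
    {τ : JSet η → Measure unitInterval} (hτ : (⨆ i, τ i Set.univ) < ⊤)
    (hrep : ∀ i, IsRepresentingMeasure (τ i) fun n => ‖(A ^ n) (basisVec (.ray i 0))‖ ^ 2)
    {ρ : Measure unitInterval} (hρ : ρ = branchMeasure τ fun i => ‖lam (branchChild i)‖) :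
    CompletelyHyperexpansive A ↔ (∀ k ≤ κ, negMoment ρ (k + 1) < ⊤) ∧
      (∀ k < κ, chainWeight (trunkSq lam) k * chainZeta (trunkSq lam) ρ (k + 1) = 1) ∧
      1 ≤ chainWeight (trunkSq lam) κ * chainZeta (trunkSq lam) ρ (κ + 1) := by
  subst hρ
  rw [← (backwardChain_trunk h hlam hτ hrep).completelyAlternating_iff_zeta,
    h.completelyHyperexpansive_iff]
  constructor
  · intro hu k hk
    simp only [dif_pos hk]
    exact hu _
  · intro hk u
    cases u with
    | trunk k hk' =>
      have h1 := hk k hk'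
      simp only [dif_pos hk'] at h1
      exact h1
    | ray i j =>
      -- The orbit of `(i, j + 1)` is the tail from index `j` of the orbit of `(i, 1)`, divided by
      -- its positive first term.
      have h1 := ((isRepresentingMeasure_iff _ _).1 (hrep i)).completelyAlternating
      have h2 := norm_ray_pos h hlam i j
      have h3 := h1.const_mul_shift (inv_nonneg.2 h2.le) j
      convert h3 using 2 with n
      rw [norm_pow_ray_add h, zero_add, inv_mul_cancel_left₀ h2.ne']

end OneBranching

/-! ### The parameter set and the sums `ζ_k` -/

section Parameters

variable {η : ℕ∞} {κ : ℕ}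

/-- The solutions of the equations `x₁ ⋯ x_k ζ_{k+1} = 1` that come from the chain of backward
extensions. -/
theorem chainWeight_mul_iff {x ζ : ℕ → ℝ} (hx : ∀ k, 0 < x (k + 1))
    (hζ : ∀ k ≤ κ, ζ (k + 1) ≤ ζ k) :
    ((∀ k < κ, chainWeight x k * ζ (k + 1) = 1) ∧ 1 ≤ chainWeight x κ * ζ (κ + 1)) ↔
      ((κ = 0 → 1 ≤ ζ 1) ∧ (0 < κ → ζ 1 = 1) ∧ 0 < ζ (κ + 1)) ∧
      (∀ k, k + 1 < κ → x (k + 1) = ζ (k + 1) / ζ (k + 2)) ∧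
      (1 ≤ κ → ζ κ / ζ (κ + 1) ≤ x κ) := by
  have hw : ∀ k, 0 < chainWeight x k := fun k => Finset.prod_pos fun j _ => hx j
  have hws : ∀ k, chainWeight x (k + 1) = chainWeight x k * x (k + 1) := fun k => by
    rw [chainWeight, Finset.prod_range_succ]
    rfl
  have hw0 : chainWeight x 0 = 1 := by simp [chainWeight]
  constructor
  · rintro ⟨h1, h2⟩
    have hpos : 0 < ζ (κ + 1) := pos_of_mul_pos_right (one_pos.trans_le h2) (hw κ).le
    refine ⟨⟨fun hκ => ?_, fun hκ => ?_, hpos⟩, fun k hk => ?_, fun hκ => ?_⟩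
    · subst hκ
      simpa [hw0] using h2
    · simpa [hw0] using h1 0 hκ
    · have h3 := h1 k (by omega)
      have h4 := h1 (k + 1) hk
      rw [hws] at h4
      have h5 : 0 < ζ (k + 2) := pos_of_mul_pos_right (one_pos.trans_eq h4.symm)
        (mul_pos (hw k) (hx k)).le
      rw [eq_div_iff h5.ne']
      refine mul_left_cancel₀ (hw k).ne' ?_
      rw [h3, ← mul_assoc, h4]
    · obtain ⟨k, rfl⟩ : ∃ k, κ = k + 1 := ⟨κ - 1, by omega⟩
      have h3 := h1 k (by omega)
      rw [hws] at h2
      rw [div_le_iff₀ hpos]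
      refine le_of_mul_le_mul_left ?_ (hw k)
      rw [h3, ← mul_assoc]
      exact h2
  · rintro ⟨⟨h0, h1, hpos⟩, h2, h3⟩
    -- The `ζ`'s decrease, so positivity of the last one gives all of them.
    have hζpos : ∀ k ≤ κ + 1, 0 < ζ k := fun k hk =>
      Nat.decreasingInduction' (P := fun k => 0 < ζ k)
        (fun j hj _ hj' => hj'.trans_le (hζ j (by omega))) hk hpos
    have h4 : ∀ k < κ, chainWeight x k * ζ (k + 1) = 1 := by
      intro k
      induction k with
      | zero =>
        intro hk
        rw [hw0, h1 hk, one_mul]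
      | succ k ih =>
        intro hk
        rw [hws, h2 k hk, mul_assoc, div_mul_cancel₀ _ (hζpos (k + 2) (by omega)).ne',
          ih (by omega)]
    refine ⟨h4, ?_⟩
    rcases Nat.eq_zero_or_pos κ with rfl | hκ
    · simpa [hw0] using h0 rfl
    · obtain ⟨k, rfl⟩ : ∃ k, κ = k + 1 := ⟨κ - 1, by omega⟩
      have h5 := h3 hκ
      rw [div_le_iff₀ hpos] at h5
      rw [hws, mul_assoc, ← h4 k (by omega)]
      exact mul_le_mul_of_nonneg_left h5 (hw k).le

/-- Finite inverse moments of `branchMeasure` make the series for `ζ_k` a difference of two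
convergent ones, and rule out a `toReal` that turns `∞` into `0`. -/
theorem zeta_eq {τ : JSet η → Measure unitInterval} {t : JSet η → ℝ}
    (hfin : ∑' i, ENNReal.ofReal (t i ^ 2) < ⊤)
    (hneg : ∀ k ≤ κ, negMoment (branchMeasure τ t) (k + 1) < ⊤) {k : ℕ} (hk : k ≤ κ + 1) :
    zeta τ t k = (∑' i, ENNReal.ofReal (t i ^ 2)).toReal -
      ∑ j ∈ Finset.range k, (negMoment (branchMeasure τ t) (j + 1)).toReal := by
  have h1 := tsum_mul_invMoment τ t k
  have h2 : ∑' i, ENNReal.ofReal (t i ^ 2) * invMoment (τ i) k ≠ ⊤ := by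
    rw [h1]
    refine (ENNReal.sum_lt_top.2 fun j hj => hneg j ?_).ne
    have := Finset.mem_range.1 hj
    omega
  rw [← ENNReal.toReal_sum fun j hj => (hneg j (by have := Finset.mem_range.1 hj; omega)).ne,
    ← h1, ENNReal.tsum_toReal_eq (ENNReal.ne_top_of_tsum_ne_top hfin.ne),
    ENNReal.tsum_toReal_eq (ENNReal.ne_top_of_tsum_ne_top h2),
    ← (ENNReal.summable_toReal hfin.ne).tsum_sub (ENNReal.summable_toReal h2)]
  refine tsum_congr fun i => ?_
  rw [ENNReal.toReal_mul, ENNReal.toReal_ofReal (sq_nonneg _)]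
  ring

theorem negMoment_lt_top_of_invMoment {τ : JSet η → Measure unitInterval} {t : JSet η → ℝ}
    (h : ∑' i, ENNReal.ofReal (t i ^ 2) * invMoment (τ i) (κ + 1) < ⊤) :
    ∀ k ≤ κ, negMoment (branchMeasure τ t) (k + 1) < ⊤ := by
  intro k hk
  rw [tsum_mul_invMoment] at h
  exact ENNReal.sum_lt_top.1 h k (Finset.mem_range.2 (by omega))

/-- The strict inequality in `paramSet` has a finite right side, so it contains the finiteness of
all inverse moments up to order `κ + 1`. After that the conditions can be read in `ℝ`. -/
theorem mem_paramSet_iff {τ : JSet η → Measure unitInterval} {t : JSet η → ℝ}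
    (ht : ∀ i, 0 < t i) (hfin : ∑' i, ENNReal.ofReal (t i ^ 2) < ⊤) :
    t ∈ paramSet η κ τ ↔ (∀ k ≤ κ, negMoment (branchMeasure τ t) (k + 1) < ⊤) ∧
      (κ = 0 → 1 ≤ zeta τ t 1) ∧ (0 < κ → zeta τ t 1 = 1) ∧ 0 < zeta τ t (κ + 1) := by
  have key : ∀ hneg : (∀ k ≤ κ, negMoment (branchMeasure τ t) (k + 1) < ⊤),
      t ∈ paramSet η κ τ ↔
        (κ = 0 → 1 ≤ zeta τ t 1) ∧ (0 < κ → zeta τ t 1 = 1) ∧ 0 < zeta τ t (κ + 1) := by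
    intro hneg
    have hsum : ∑ j ∈ Finset.range (κ + 1), negMoment (branchMeasure τ t) (j + 1) < ⊤ :=
      ENNReal.sum_lt_top.2 fun j hj => hneg j (Nat.lt_succ_iff.1 (Finset.mem_range.1 hj))
    have h0 := hneg 0 κ.zero_le
    unfold paramSet
    rw [Set.mem_ofPred_eq, zeta_eq hfin hneg (by omega), zeta_eq hfin hneg le_rfl,
      tsum_mul_invMoment, tsum_mul_invMoment,
      ← ENNReal.toReal_sum fun j hj => (hneg j (Nat.lt_succ_iff.1 (Finset.mem_range.1 hj))).ne,
      sub_pos, ENNReal.toReal_lt_toReal hsum.ne hfin.ne]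
    simp only [Finset.sum_range_one, zero_add] at h0 ⊢
    have h1 : (1 + negMoment (branchMeasure τ t) 1).toReal =
        1 + (negMoment (branchMeasure τ t) 1).toReal := by
      rw [ENNReal.toReal_add ENNReal.one_ne_top h0.ne, ENNReal.toReal_one]
    have h2 : 1 + negMoment (branchMeasure τ t) 1 ≠ ⊤ :=
      ENNReal.add_ne_top.2 ⟨ENNReal.one_ne_top, h0.ne⟩
    rw [← ENNReal.toReal_le_toReal h2 hfin.ne, ← ENNReal.toReal_eq_toReal_iff' hfin.ne h2, h1,
      le_sub_iff_add_le, sub_eq_iff_eq_add]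
    exact ⟨fun h => h.2.2, fun h => ⟨ht, hfin, h⟩⟩
  constructor
  · intro h
    have hneg : ∀ k ≤ κ, negMoment (branchMeasure τ t) (k + 1) < ⊤ :=
      negMoment_lt_top_of_invMoment (h.2.2.2.2.trans hfin)
    exact ⟨hneg, (key hneg).1 h⟩
  · rintro ⟨hneg, h⟩
    exact (key hneg).2 h

theorem zeta_antitone {τ : JSet η → Measure unitInterval} {t : JSet η → ℝ}
    (hfin : ∑' i, ENNReal.ofReal (t i ^ 2) < ⊤)
    (hneg : ∀ k ≤ κ, negMoment (branchMeasure τ t) (k + 1) < ⊤) :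
    ∀ k ≤ κ, zeta τ t (k + 1) ≤ zeta τ t k := by
  intro k hk
  rw [zeta_eq hfin hneg (by omega), zeta_eq hfin hneg (by omega : k ≤ κ + 1),
    Finset.sum_range_succ]
  linarith [ENNReal.toReal_nonneg (a := negMoment (branchMeasure τ t) (k + 1))]

theorem zeta_pos {τ : JSet η → Measure unitInterval} {t : JSet η → ℝ}
    (h : t ∈ paramSet η κ τ) : ∀ k ≤ κ + 1, 0 < zeta τ t k := fun k hk =>
  Nat.decreasingInduction' (P := fun k => 0 < zeta τ t k)
    (fun j _ _ hj' => hj'.trans_le (zeta_antitone h.2.1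
      ((mem_paramSet_iff h.1 h.2.1).1 h).1 j (by omega))) hk
    ((mem_paramSet_iff h.1 h.2.1).1 h).2.2.2

/-- Complete hyperexpansivity of a bounded weighted shift with nonzero weights and prescribed
representing measures of the rays, in terms of the weights. -/
theorem completelyHyperexpansive_iff_weights {lam : (tree η κ).NonRoot → ℂ}
    {A : Ell2 (Vertex η κ) →L[ℂ] Ell2 (Vertex η κ)}
    (h : (tree η κ).IsShift lam A) (hlam : ∀ v, lam v ≠ 0)
    {τ : JSet η → Measure unitInterval} (hτ : (⨆ i, τ i Set.univ) < ⊤)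
    (hrep : ∀ i, IsRepresentingMeasure (τ i) fun n => ‖(A ^ n) (basisVec (.ray i 0))‖ ^ 2)
    {t : JSet η → ℝ} (ht : ∀ i, ‖lam (branchChild i)‖ = t i) :
    CompletelyHyperexpansive A ↔ t ∈ paramSet η κ τ ∧
      (∀ k, ∀ hk : k + 1 < κ, ‖lam (trunkNode k (Nat.lt_of_succ_lt hk))‖ ^ 2 =
        zeta τ t (k + 1) / zeta τ t (k + 2)) ∧
      (∀ hκ : 1 ≤ κ, zeta τ t κ / zeta τ t (κ + 1) ≤ ‖lam (rootChild η hκ)‖ ^ 2) := by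
  obtain rfl : (fun i => ‖lam (branchChild i)‖) = t := funext ht
  set t : JSet η → ℝ := fun i => ‖lam (branchChild i)‖
  have hpos : ∀ i, 0 < t i := fun i => norm_pos_iff.2 (hlam _)
  have hfin : ∑' i, ENNReal.ofReal (t i ^ 2) < ⊤ := tsum_branch_lt_top h
  rw [completelyHyperexpansive_iff_zeta h hlam hτ hrep rfl, mem_paramSet_iff hpos hfin, and_assoc]
  refine and_congr_right fun hneg => ?_
  have hz : ∀ k ≤ κ + 1, chainZeta (trunkSq lam) (branchMeasure τ t) k = zeta τ t k :=
    fun k hk => (zeta_eq hfin hneg hk).symm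
  have h1 := chainWeight_mul_iff (backwardChain_trunk h hlam hτ hrep).pos (zeta_antitone hfin hneg)
  have h2 : (∀ k < κ, chainWeight (trunkSq lam) k *
      chainZeta (trunkSq lam) (branchMeasure τ t) (k + 1) = 1) ↔
      ∀ k < κ, chainWeight (trunkSq lam) k * zeta τ t (k + 1) = 1 :=
    forall₂_congr fun k hk => by rw [hz (k + 1) (by omega)]
  rw [hz (κ + 1) le_rfl, h2, h1]
  refine and_congr_right fun _ => and_congr (forall_congr' fun k => ?_) ?_
  · refine forall_congr' fun hk => ?_
    simp only [trunkSq, dif_pos (Nat.lt_of_succ_lt hk)]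
  · refine forall_congr' fun hκ => ?_
    obtain ⟨k, rfl⟩ : ∃ k, κ = k + 1 := ⟨κ - 1, by omega⟩
    simp only [trunkSq, dif_pos k.lt_succ_self]
    rfl

end Parameters

/-! ### The explicit weights, the map `Φ` and extremality -/

section Model

variable {η : ℕ∞} {κ : ℕ} {τ : JSet η → Measure unitInterval} {t : JSet η → ℝ}

theorem modelWeight_ray_succ (i : JSet η) (j : ℕ) :
    modelWeight τ t (.ray i (j + 1) : Vertex η κ) =
      Real.sqrt ((1 + geomIntegral (τ i) (j + 1)) / (1 + geomIntegral (τ i) j)) := by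
  rcases j with _ | j
  · have h1 : geomIntegral (τ i) 1 = (τ i).real Set.univ := by simp [geomIntegral]
    rw [modelWeight, zero_add, h1, geomIntegral_zero, add_zero, div_one]
  · rfl

/-- For `κ ≥ 1` membership in the parameter set gives `ζ_1 = 1`, so the separate formula at `k = 0`
is an instance of the general one. -/
theorem modelWeight_trunk (h : t ∈ paramSet η κ τ) (k : ℕ) (hk : k < κ) :
    modelWeight τ t (.trunk k hk.le : Vertex η κ) =
      Real.sqrt (zeta τ t (k + 1) / zeta τ t (k + 2)) := by
  rw [modelWeight]
  rcases k with _ | k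
  · rw [if_pos rfl, zero_add, zero_add,
      ((mem_paramSet_iff h.1 h.2.1).1 h).2.2.1 (by omega), Real.sqrt_div zero_le_one,
      Real.sqrt_one]
  · rw [if_neg (by omega)]

theorem modelWeight_ray_succ_pos (i : JSet η) (j : ℕ) :
    0 < modelWeight τ t (.ray i (j + 1) : Vertex η κ) := by
  rw [modelWeight_ray_succ]
  exact Real.sqrt_pos.2 (div_pos (by linarith [geomIntegral_nonneg (τ i) (j + 1)])
    (by linarith [geomIntegral_nonneg (τ i) j]))

theorem modelWeight_pos (h : t ∈ paramSet η κ τ) (v : (tree η κ).NonRoot) :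
    0 < modelWeight τ t v.1 := by
  rcases nonRoot_cases v with ⟨i, j, rfl⟩ | ⟨k, hk, rfl⟩
  · cases j with
    | zero => exact h.1 i
    | succ j => exact modelWeight_ray_succ_pos i j
  · change 0 < modelWeight τ t (.trunk k hk.le : Vertex η κ)
    rw [modelWeight_trunk h k hk]
    exact Real.sqrt_pos.2 (div_pos (zeta_pos h _ (by omega)) (zeta_pos h _ (by omega)))

theorem modelWeight_rootChild (h : t ∈ paramSet η κ τ) (hκ : 1 ≤ κ) :
    modelWeight τ t (rootChild η hκ).1 = Real.sqrt (zeta τ t κ / zeta τ t (κ + 1)) := by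
  obtain ⟨k, rfl⟩ : ∃ k, κ = k + 1 := ⟨κ - 1, by omega⟩
  exact modelWeight_trunk h k k.lt_succ_self

theorem rayNode_ne_rootChild (hκ : 1 ≤ κ) (i : JSet η) (j : ℕ) :
    rayNode i j ≠ rootChild η hκ :=
  rayNode_ne_trunkNode i j _ (Nat.sub_one_lt_of_le hκ le_rfl)

theorem branchChild_ne_rootChild (hκ : 1 ≤ κ) (i : JSet η) :
    (branchChild i : (tree η κ).NonRoot) ≠ rootChild η hκ :=
  rayNode_ne_rootChild hκ i 0

/-- A weighted shift is bounded if it has square summable weights at the branching vertex and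
the weights of the model along the rays. -/
theorem exists_isShift_of_ray {lam : (tree η κ).NonRoot → ℂ}
    (hτ : (⨆ i, τ i Set.univ) < ⊤)
    (hfin : ∑' i, ENNReal.ofReal (‖lam (branchChild i)‖ ^ 2) < ⊤)
    (hray : ∀ i j, ‖lam (rayNode i (j + 1))‖ =
      Real.sqrt ((1 + geomIntegral (τ i) (j + 1)) / (1 + geomIntegral (τ i) j))) :
    ∃ A, (tree η κ).IsShift lam A := by
  have hle : ∀ i j, ‖lam (rayNode i (j + 1))‖ₑ ^ 2 ≤ 1 + ⨆ i, τ i Set.univ := by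
    intro i j
    have hfi := isFiniteMeasure_of_iSup hτ i
    have hg := geomIntegral_nonneg (τ i) j
    have hg' := geomIntegral_nonneg (τ i) (j + 1)
    have h1 : (1 + geomIntegral (τ i) (j + 1)) / (1 + geomIntegral (τ i) j) ≤
        1 + (τ i).real Set.univ := by
      -- The numerator exceeds the denominator by a moment of at most the total mass, and the
      -- denominator is at least `1`.
      rw [div_le_iff₀ (by linarith), geomIntegral_succ]
      have := powMoment_le (τ i) j
      have := measureReal_nonneg (μ := τ i) (s := Set.univ)
      nlinarith
    rw [← ofReal_norm_sq, hray, Real.sq_sqrt (div_nonneg (by linarith) (by linarith))]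
    refine (ENNReal.ofReal_le_ofReal h1).trans ?_
    rw [ENNReal.ofReal_add zero_le_one measureReal_nonneg, ENNReal.ofReal_one,
      ofReal_measureReal]
    gcongr
    exact le_iSup (fun i => τ i Set.univ) i
  refine DirectedTree.exists_isShift (C := ∑' i, ENNReal.ofReal (‖lam (branchChild i)‖ ^ 2) +
    (1 + ⨆ i, τ i Set.univ) + ∑ k : Fin κ, ‖lam (trunkNode k k.2)‖ₑ ^ 2) ?_ fun u => ?_
  · refine ENNReal.add_ne_top.2 ⟨ENNReal.add_ne_top.2 ⟨hfin.ne,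
      ENNReal.add_ne_top.2 ⟨ENNReal.one_ne_top, hτ.ne⟩⟩, ?_⟩
    exact (ENNReal.sum_lt_top.2 fun k _ => by simp).ne
  · cases u with
    | ray i j =>
      rw [childSum_ray, Pi.one_apply, mul_one]
      exact (hle i j).trans (le_add_self.trans le_self_add)
    | trunk k hk =>
      rcases k with _ | k
      · rw [childSum_trunk_zero]
        simp only [Pi.one_apply, mul_one, ofReal_norm_sq]
        exact le_self_add.trans le_self_add
      · rw [childSum_trunk_succ, Pi.one_apply, mul_one]
        exact (Finset.single_le_sum (f := fun k : Fin κ => ‖lam (trunkNode k k.2)‖ₑ ^ 2)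
          (fun _ _ => zero_le) (Finset.mem_univ (⟨k, hk⟩ : Fin κ))).trans le_add_self

/-- The members of `V` with positive weights `λ`, in terms of `λ`. -/
theorem realShift_mem_shiftSet_iff (hτ : (⨆ i, τ i Set.univ) < ⊤)
    {lam : (tree η κ).NonRoot → ℝ} (hlam : ∀ v, 0 < lam v)
    (ht : ∀ i, lam (branchChild i) = t i) :
    realShift lam ∈ shiftSet η κ τ ↔ t ∈ paramSet η κ τ ∧
      (∀ v, (∀ hκ : 1 ≤ κ, v ≠ rootChild η hκ) → lam v = modelWeight τ t v.1) ∧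
      ∀ hκ : 1 ≤ κ, Real.sqrt (zeta τ t κ / zeta τ t (κ + 1)) ≤ lam (rootChild η hκ) := by
  have hnorm : ∀ v, ‖(lam v : ℂ)‖ = lam v := fun v => by
    rw [Complex.norm_real, Real.norm_of_nonneg (hlam v).le]
  have hne : ∀ v, (lam v : ℂ) ≠ 0 := fun v => Complex.ofReal_ne_zero.2 (hlam v).ne'
  have htn : ∀ i, ‖(lam (branchChild i) : ℂ)‖ = t i := fun i => by rw [hnorm, ht]
  have hfinite := isFiniteMeasure_of_iSup hτ
  constructor
  · rintro ⟨lam', A, heq, -, hA, hCH, hrep⟩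
    -- The weights witnessing membership need not be `lam`, but they define the same operator.
    have hA' : (tree η κ).IsShift (fun v => (lam v : ℂ)) A := Eq.trans heq hA
    obtain ⟨h1, h2, h3⟩ := (completelyHyperexpansive_iff_weights hA' hne hτ hrep htn).1 hCH
    have hray := fun i => (isRepresentingMeasure_ray_iff hA' τ i).1 (hrep i)
    refine ⟨h1, fun v hv => ?_, fun hκ => ?_⟩
    · rcases nonRoot_cases v with ⟨i, j, rfl⟩ | ⟨k, hk, rfl⟩
      · cases j with
        | zero => exact ht i
        | succ j =>
          rw [← hnorm, hray]
          exact (modelWeight_ray_succ i j).symm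
      -- Otherwise `-k` would be the child of the root, which is excluded.
      · have hk' : k + 1 < κ := by
          by_contra hk'
          obtain rfl : κ = k + 1 := by omega
          exact hv (by omega) rfl
        have h4 := h2 k hk'
        rw [hnorm] at h4
        refine Eq.trans ?_ (modelWeight_trunk h1 k hk).symm
        rw [← h4, Real.sqrt_sq (hlam _).le]
    · have h4 := h3 hκ
      rw [hnorm] at h4
      exact Real.sqrt_le_iff.2 ⟨(hlam _).le, h4⟩
  · rintro ⟨h1, h2, h3⟩
    have hray : ∀ i j, ‖(lam (rayNode i (j + 1)) : ℂ)‖ =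
        Real.sqrt ((1 + geomIntegral (τ i) (j + 1)) / (1 + geomIntegral (τ i) j)) := by
      intro i j
      rw [hnorm, h2 _ fun hκ => rayNode_ne_rootChild hκ i (j + 1)]
      exact modelWeight_ray_succ i j
    obtain ⟨A, hA⟩ := exists_isShift_of_ray (lam := fun v => (lam v : ℂ)) hτ
      (by simp only [htn]; exact h1.2.1) hray
    have hrep := fun i => (isRepresentingMeasure_ray_iff hA τ i).2 (hray i)
    refine ⟨lam, A, rfl, hlam, hA,
      (completelyHyperexpansive_iff_weights hA hne hτ hrep htn).2 ⟨h1, fun k hk => ?_,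
        fun hκ => ?_⟩, hrep⟩
    · rw [hnorm, h2 _ fun hκ =>
        trunkNode_ne_trunkNode _ (Nat.sub_one_lt_of_le hκ le_rfl) (by omega)]
      change modelWeight τ t (.trunk k _ : Vertex η κ) ^ 2 = _
      rw [modelWeight_trunk h1 k (by omega), Real.sq_sqrt]
      exact div_nonneg (zeta_pos h1 _ (by omega)).le (zeta_pos h1 _ (by omega)).le
    · rw [hnorm]
      exact (Real.sqrt_le_iff.1 (h3 hκ)).2

theorem modelMap_mem_shiftSet (hτ : (⨆ i, τ i Set.univ) < ⊤) (h : t ∈ paramSet η κ τ) :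
    modelMap η κ τ t ∈ shiftSet η κ τ :=
  (realShift_mem_shiftSet_iff hτ (modelWeight_pos h) fun _ => rfl).2
    ⟨h, fun _ _ => rfl, fun hκ => (modelWeight_rootChild h hκ).ge⟩

theorem realShift_injOn {lam lam' : (tree η κ).NonRoot → ℝ}
    (h : realShift lam ∈ shiftSet η κ τ) (heq : realShift lam = realShift lam') :
    lam = lam' := by
  obtain ⟨mu, A, h1, -, hA, -⟩ := h
  have h2 : (tree η κ).IsShift (fun v => (lam v : ℂ)) A := Eq.trans h1 hA
  have h3 : (tree η κ).IsShift (fun v => (lam' v : ℂ)) A := Eq.trans heq.symm h2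
  funext v
  exact Complex.ofReal_injective (congrFun (h2.weights_unique h3 heq) v)

theorem modelMap_injOn (hτ : (⨆ i, τ i Set.univ) < ⊤) :
    Set.InjOn (modelMap η κ τ) (paramSet η κ τ) := by
  intro t ht t' _ heq
  have h1 := realShift_injOn (modelMap_mem_shiftSet hτ ht) heq
  funext i
  exact congrFun h1 (branchChild i)

theorem isExtremal_modelMap (hτ : (⨆ i, τ i Set.univ) < ⊤) (h : t ∈ paramSet η κ τ)
    (hκ : 1 ≤ κ) : IsExtremal hκ (modelMap η κ τ t) := by
  have hpos := modelWeight_pos h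
  have hnorm : ∀ v : (tree η κ).NonRoot,
      ‖(modelWeight τ t v.1 : ℂ)‖ = modelWeight τ t v.1 := fun v => by
    rw [Complex.norm_real, Real.norm_of_nonneg (hpos v).le]
  have hne : ∀ v : (tree η κ).NonRoot, (modelWeight τ t v.1 : ℂ) ≠ 0 := fun v =>
    Complex.ofReal_ne_zero.2 (hpos v).ne'
  have hfinite := isFiniteMeasure_of_iSup hτ
  obtain ⟨mu, A, heq, -, hmu, hCH, hrep⟩ := modelMap_mem_shiftSet hτ h
  have hA : (tree η κ).IsShift (fun v => (modelWeight τ t v.1 : ℂ)) A := Eq.trans heq hmu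
  refine ⟨fun v => (modelWeight τ t v.1 : ℂ), A, rfl, hne, hA, hCH,
    ⟨_, A, hne, hA, hCH, fun _ _ => rfl, rfl⟩, ?_⟩
  rintro r ⟨lam', B, hne', hB, hCH', hagree, rfl⟩
  -- A competitor shares all weights on the rays, hence the measures and `t`, so the same lower
  -- bound applies to its weight at the root's child.
  have hrep' : ∀ i, IsRepresentingMeasure (τ i) fun n => ‖(B ^ n) (basisVec (.ray i 0))‖ ^ 2 := by
    intro i
    refine (isRepresentingMeasure_ray_iff hB τ i).2 fun j => ?_
    rw [← hagree _ (rayNode_ne_rootChild hκ i (j + 1)), hnorm]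
    exact modelWeight_ray_succ i j
  have ht : ∀ i, ‖lam' (branchChild i)‖ = t i := by
    intro i
    rw [← hagree _ (branchChild_ne_rootChild hκ i), hnorm]
    rfl
  have h1 := ((completelyHyperexpansive_iff_weights hB hne' hτ hrep' ht).1 hCH').2.2 hκ
  rw [norm_apply_root hA hκ, norm_apply_root hB hκ, hnorm, modelWeight_rootChild h hκ]
  exact Real.sqrt_le_iff.2 ⟨norm_nonneg _, h1⟩

/-- The weight at the child of the root of an extremal shift is the least possible one. -/
theorem eq_modelWeight_of_isExtremal (hτ : (⨆ i, τ i Set.univ) < ⊤) (hκ : 1 ≤ κ)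
    {lam : (tree η κ).NonRoot → ℝ} (hlam : ∀ v, 0 < lam v)
    (hmem : realShift lam ∈ shiftSet η κ τ) (hext : IsExtremal hκ (realShift lam)) (v) :
    lam v = modelWeight τ (fun i => lam (branchChild i)) v.1 := by
  obtain ⟨h1, h2, h3⟩ := (realShift_mem_shiftSet_iff hτ hlam fun _ => rfl).1 hmem
  by_cases hv : v = rootChild η hκ
  · subst hv
    rw [modelWeight_rootChild h1 hκ]
    refine le_antisymm ?_ (h3 hκ)
    obtain ⟨mu, A, heq, -, hA, -, hleast⟩ := hext
    have hA' : (tree η κ).IsShift (fun v => (lam v : ℂ)) A := Eq.trans heq hA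
    have hmu : (fun v => (lam v : ℂ)) = mu := hA'.weights_unique hA heq
    have hpos := modelWeight_pos h1
    obtain ⟨nu, B, heq', -, hnu, hCH, -⟩ := modelMap_mem_shiftSet hτ h1
    have hB : (tree η κ).IsShift
        (fun v => (modelWeight τ (fun i => lam (branchChild i)) v.1 : ℂ)) B :=
      Eq.trans heq' hnu
    -- The model shift with the same `t` is an admissible competitor, and its root weight is the
    -- lower bound itself.
    have h4 := hleast.2 ⟨_, B, fun v => Complex.ofReal_ne_zero.2 (hpos v).ne', hB, hCH,
      fun v hv => hmu ▸ congrArg Complex.ofReal (h2 v fun _ => hv), rfl⟩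
    rw [norm_apply_root hA' hκ, norm_apply_root hB hκ, Complex.norm_real, Complex.norm_real,
      Real.norm_of_nonneg (hlam _).le, Real.norm_of_nonneg (hpos _).le,
      modelWeight_rootChild h1 hκ] at h4
    exact h4
  · exact h2 v fun _ => hv

end Model

/-! ### The parametrization theorem -/

theorem mainTheorem11 (η : ℕ∞) (hη : 2 ≤ η) (κ : ℕ)
    (τ : JSet η → Measure unitInterval) (hτ : (⨆ i, τ i Set.univ) < ⊤) :
    (κ = 0 →
      Set.BijOn (modelMap η κ τ) (paramSet η κ τ) (shiftSet η κ τ) ∧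
      ∀ lam : (tree η κ).NonRoot → ℝ, (∀ v, 0 < lam v) → realShift lam ∈ shiftSet η κ τ →
        (fun i => lam (branchChild i)) ∈ paramSet η κ τ ∧
        ∀ v, lam v = modelWeight τ (fun i => lam (branchChild i)) v.1) ∧
    (∀ hκ : 1 ≤ κ,
      Set.BijOn (modelMap η κ τ) (paramSet η κ τ) (extremalSet η hκ τ) ∧
      (∀ lam : (tree η κ).NonRoot → ℝ, (∀ v, 0 < lam v) → realShift lam ∈ shiftSet η κ τ →
        (fun i => lam (branchChild i)) ∈ paramSet η κ τ ∧
        lam (rootChild η hκ) ∈ Set.Ici (Real.sqrt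
          (zeta τ (fun i => lam (branchChild i)) κ /
            zeta τ (fun i => lam (branchChild i)) (κ + 1))) ∧
        ∀ v, v ≠ rootChild η hκ →
          lam v = modelWeight τ (fun i => lam (branchChild i)) v.1) ∧
      (∀ t ∈ paramSet η κ τ,
        ∀ ϑ ∈ Set.Ici (Real.sqrt (zeta τ t κ / zeta τ t (κ + 1))),
        ∀ lam : (tree η κ).NonRoot → ℝ,
          (∀ v, v ≠ rootChild η hκ → lam v = modelWeight τ t v.1) →
          lam (rootChild η hκ) = ϑ → realShift lam ∈ shiftSet η κ τ)) := by
  constructor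
  · rintro rfl
    have hmain : ∀ lam : (tree η 0).NonRoot → ℝ, (∀ v, 0 < lam v) →
        realShift lam ∈ shiftSet η 0 τ → (fun i => lam (branchChild i)) ∈ paramSet η 0 τ ∧
          ∀ v, lam v = modelWeight τ (fun i => lam (branchChild i)) v.1 := by
      intro lam hlam hmem
      obtain ⟨h1, h2, -⟩ := (realShift_mem_shiftSet_iff hτ hlam fun _ => rfl).1 hmem
      -- For `κ = 0` there is no exceptional vertex, so every weight is determined.
      exact ⟨h1, fun v => h2 v fun hκ => absurd hκ (by omega)⟩
    refine ⟨⟨fun t ht => modelMap_mem_shiftSet hτ ht, modelMap_injOn hτ, ?_⟩, hmain⟩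
    intro S hS
    obtain ⟨lam, -, rfl, hlam, -⟩ := id hS
    obtain ⟨h1, h2⟩ := hmain lam hlam hS
    exact ⟨_, h1, congrArg realShift (funext fun v => (h2 v).symm)⟩
  · intro hκ
    refine ⟨⟨fun t ht => ⟨modelMap_mem_shiftSet hτ ht, isExtremal_modelMap hτ ht hκ⟩,
      modelMap_injOn hτ, ?_⟩, ?_, ?_⟩
    · rintro S ⟨hS, hext⟩
      obtain ⟨lam, -, rfl, hlam, -⟩ := id hS
      have h1 := ((realShift_mem_shiftSet_iff hτ hlam fun _ => rfl).1 hS).1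
      exact ⟨_, h1, congrArg realShift (funext fun v =>
        (eq_modelWeight_of_isExtremal hτ hκ hlam hS hext v).symm)⟩
    · intro lam hlam hmem
      obtain ⟨h1, h2, h3⟩ := (realShift_mem_shiftSet_iff hτ hlam fun _ => rfl).1 hmem
      exact ⟨h1, h3 hκ, fun v hv => h2 v fun _ => hv⟩
    · intro t ht ϑ hϑ lam hlam hroot
      -- The lower bound for `ϑ` is itself a weight of the model, hence positive.
      have hpos : ∀ v, 0 < lam v := by
        intro v
        by_cases hv : v = rootChild η hκ
        · rw [hv, hroot]
          refine lt_of_lt_of_le ?_ (Set.mem_Ici.1 hϑ)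
          rw [← modelWeight_rootChild ht hκ]
          exact modelWeight_pos ht _
        · rw [hlam v hv]
          exact modelWeight_pos ht v
      refine (realShift_mem_shiftSet_iff hτ hpos fun i =>
        hlam _ (branchChild_ne_rootChild hκ i)).2 ⟨ht, fun v hv => hlam v (hv hκ), fun _ => ?_⟩
      rw [hroot]
      exact hϑ
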